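/- **Cubical $\omega$-categories.** A cubical $\omega$-category $\mathbf C$ means a strict cubical $\omega$-category with connections in the sense of Al-Agl, Brown and Steiner: sets $\mathbf C_n$ ($n\ge 0$) with faces $\partial_i^\alpha:\mathbf C_n\to\mathbf C_{n-1}$, degeneracies $\epsilon_i:\mathbf C_{n-1}\to\mathbf C_n$, compositions $A\star_i B$ (defined for $A,B\in\mathbf C_n$ when $\partial_i^+A=\partial_i^-B$) for $1\le i\le n$, and connections $\Gamma_i^\alpha:\mathbf C_n\to\mathbf C_{n+1}$ for $1\le i\le n$ (with $\alpha=\pm$), satisfying their axioms. Let $A\in\mathbf C_n$. * For $1\le i\le n$, $B\in\mathbf C_n$ is an $R_i$-inverse of $A$ if $A\star_iB$ and $B\star_iA$ are defined, $A\star_iB=\epsilon_i\partial_i^-A$ and $B\star_iA=\epsilon_i\partial_i^+A$. $A$ is $R_i$-invertible if it has an $R_i$-inverse. * For $1\le i<n$, $B\in\mathbf C_n$ is a $T_i$-inverse of $A$ if $\partial_i^\alpha A=\partial_{i+1}^\alpha B$ and $\partial_{i+1}^\alpha A=\partial_i^\alpha B$ for $\alpha=\pm$, and the equation $$(\Gamma_i^+\partial_i^-B\star_iB)\star_{i+1}(A\star_i\Gamma_i^-\partial_i^+A)=\Gamma_i^-\partial_i^-A\star_i\Gamma_i^+\partial_i^+B$$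 and the one obtained by exchanging $A$ and $B$ hold. $A$ is $T_i$-invertible if it has a $T_i$-inverse. * Put $\psi_iA=\Gamma_i^+\partial_{i+1}^-A\star_{i+1}A\star_{i+1}\Gamma_i^-\partial_{i+1}^+A$ for $1\le i<n$. For $n\ge1$, $A$ is invertible if $\psi_1\psi_2\cdots\psi_{n-1}A$ is $R_1$-invertible. For $p\in\mathbb N\cup\{\omega\}$, $\mathbf C$ is a cubical $(\omega,p)$-category if for all $n>p$ every $n$-cell is invertible. **Augmented directed complexes.** An ADC $K$ is a chain complex of abelian groups $(K_n,d)_{n\ge0}$ with an augmentation $e:K_0\to\mathbb Z$, $e\circ d=0$, and submonoids $K_n^*\subseteq K_n$; morphisms are the augmentation preserving chain maps that send distinguished submonoids into distinguished submonoids. An element $x\in K_n$ is invertible (in $K$) if $x\in K_n^*$ and $-x\in K_n^*$. $K$ is an $(\omega,p)$-ADC if $K_n^*=K_n$ for all $n>p$. **The functor $\mathcal Z^{\mathbf C}$.** $(\mathcal Z^{\mathbf C}\mathbf C)_n$ is the quotient of $\mathbb Z[\mathbf C_n]$ by the relations $[A\star_kB]=[A]+[B]$ and $[\Gamma_k^\alpha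 A]=0$; its distinguished submonoid is the image of $\mathbb N[\mathbf C_n]$; $d[A]=\sum_{1\le i\le n,\ \alpha=\pm}\alpha(-1)^i[\partial_i^\alpha A]$, and $e[A]=1$ for $A\in\mathbf C_0$. **The functor $N^{\mathbf C}$.** Let $\square^n_k$ be the set of sequences $s:\{1,\dots,n\}\to\{-,\odot,+\}$ with exactly $k$ values $\odot$. The ADC of the $n$-cube, $\square^n$, is in degree $k$ the free abelian group on $\square^n_k$, with distinguished submonoid $\mathbb N[\square^n_k]$, $e[s]=1$ for $s\in\square^n_0$, and $$d[s]=\sum_{r=1}^k(-1)^r\big([s^{r,+}]-[s^{r,-}]\big),$$ where $s^{r,\alpha}$ is $s$ with its $r$-th letter $\odot$ replaced by $\alpha$. For an ADC $K$, $N^{\mathbf C}K$ is the cubical $\omega$-category with $(N^{\mathbf C}K)_n=\mathbf{ADC}(\square^n,K)$ and, for cells $A,B$ and a sequence $s$: * $(\partial_i^\alpha A)[s]=A[s']$, where $s'$ is $s$ with $\alpha$ inserted at place $i$; * $(\epsilon_iA)[s]=0$ if $s(i)=\odot$, and otherwise it is $A[s']$, where $s'$ is $s$ with the letter at place $i$ deleted;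 * $(\Gamma_i^\alpha A)[s]=A[s']$, where $s'$ is $s$ with the two letters $s(i),s(i+1)$ replaced by one letter: by the other one of the two if one of them is $\alpha$, and by $-\alpha$ if both are $-\alpha$; in the remaining cases $(\Gamma_i^\alpha A)[s]=0$; * $(A\star_iB)[s]$ is $A[s]+B[s]$, $A[s]$ or $B[s]$, according to whether $s(i)$ is $\odot$, $-$ or $+$. If $s(i)\ne\odot$, $R_is$ denotes $s$ with the sign $s(i)$ reversed; $\tau_i$ denotes the transposition of $i$ and $i+1$. **Proposition.** (1) Let $\mathbf C$ be a cubical $\omega$-category and $A\in\mathbf C_n$. If $A$ is $R_i$-invertible for some $1\le i\le n$, or $T_i$-invertible for some $1\le i<n$, then $[A]$ is invertible in $\mathcal Z^{\mathbf C}\mathbf C$. If $\mathbf C$ is a cubical $(\omega,p)$-category, $p\in\mathbb N\cup\{\omega\}$, then $\mathcal Z^{\mathbf C}\mathbf C$ is an $(\omega,p)$-ADC. (2) Let $K$ be an ADC and $A\in(N^{\mathbf C}K)_n=\mathbf{ADC}(\square^n,K)$. * Let $1\le i\le n$. If for all $k$ and all $s\in\square^n_k$ with $s(i)=\odot$ the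 element $A[s]$ is invertible in $K$, then $A$ is $R_i$-invertible, and its $R_i$-inverse $R_iA$ is given by $R_iA[s]=-A[s]$ if $s(i)=\odot$ and $R_iA[s]=A[R_is]$ if $s(i)\neq\odot$. * Let $1\le i<n$. If for all $k$ and all $s\in\square^n_k$ with $s(i)=s(i+1)=\odot$ the element $A[s]$ is invertible in $K$, then $A$ is $T_i$-invertible, and its $T_i$-inverse $T_iA$ is given by $T_iA[s]=-A[s]$ if $s(i)=s(i+1)=\odot$ and $T_iA[s]=A[s\circ\tau_i]$ otherwise. If $K$ is an $(\omega,p)$-ADC, $p\in\mathbb N\cup\{\omega\}$, then $N^{\mathbf C}K$ is a cubical $(\omega,p)$-category. -/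

import Mathlib

universe u v w

/-- A (strict) cubical `ω`-category with connections. Signs are Booleans: `false` is `-`, `true`
is `+`. Directions are numbered from `0`: the face maps of an `(n+1)`-cell are indexed by
`Fin (n+1)`. The composite `comp i A B h` is defined exactly when `∂ᵢ⁺ A = ∂ᵢ⁻ B`. In the axioms
for composites, hypotheses saying that the composites occurring in an equation are defined are
always listed, although some of them follow from the other axioms. -/
structure CubicalOmegaCategory where
  /-- the set of `n`-cells -/
  cell : ℕ → Type u
  /-- faces `∂ᵢ^α` -/
  face : ∀ {n : ℕ}, Fin (n + 1) → Bool → cell (n + 1) → cell n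
  /-- degeneracies `εᵢ` -/
  deg : ∀ {n : ℕ}, Fin (n + 1) → cell n → cell (n + 1)
  /-- connections `Γᵢ^α` -/
  conn : ∀ {n : ℕ}, Fin (n + 1) → Bool → cell (n + 1) → cell (n + 2)
  /-- partial compositions `A ⋆ᵢ B` -/
  comp : ∀ {n : ℕ} (i : Fin (n + 1)) (A B : cell (n + 1)),
    face i true A = face i false B → cell (n + 1)
  face_face : ∀ {n : ℕ} (i j : Fin (n + 1)) (_ : i ≤ j) (α β : Bool) (A : cell (n + 2)),
    face j α (face i.castSucc β A) = face i β (face j.succ α A)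
  face_deg_self : ∀ {n : ℕ} (i : Fin (n + 1)) (α : Bool) (A : cell n), face i α (deg i A) = A
  face_deg_lt : ∀ {n : ℕ} (i j : Fin (n + 1)) (_ : i ≤ j) (α : Bool) (A : cell (n + 1)),
    face i.castSucc α (deg j.succ A) = deg j (face i α A)
  face_deg_gt : ∀ {n : ℕ} (i j : Fin (n + 1)) (_ : i ≤ j) (α : Bool) (A : cell (n + 1)),
    face j.succ α (deg i.castSucc A) = deg i (face j α A)
  face_conn_lt : ∀ {n : ℕ} (i j : Fin (n + 1)) (_ : i ≤ j) (α β : Bool) (A : cell (n + 2)),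
    face i.castSucc.castSucc α (conn j.succ β A) = conn j β (face i.castSucc α A)
  face_conn_gt : ∀ {n : ℕ} (i j : Fin (n + 1)) (_ : j ≤ i) (α β : Bool) (A : cell (n + 2)),
    face i.succ.succ α (conn j.castSucc β A) = conn j β (face i.succ α A)
  face_conn_castSucc : ∀ {n : ℕ} (j : Fin (n + 1)) (α : Bool) (A : cell (n + 1)),
    face j.castSucc α (conn j α A) = A
  face_conn_succ : ∀ {n : ℕ} (j : Fin (n + 1)) (α : Bool) (A : cell (n + 1)),
    face j.succ α (conn j α A) = A
  face_conn_castSucc_not : ∀ {n : ℕ} (j : Fin (n + 1)) (α : Bool) (A : cell (n + 1)),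
    face j.castSucc α (conn j (!α) A) = deg j (face j α A)
  face_conn_succ_not : ∀ {n : ℕ} (j : Fin (n + 1)) (α : Bool) (A : cell (n + 1)),
    face j.succ α (conn j (!α) A) = deg j (face j α A)
  deg_deg : ∀ {n : ℕ} (i j : Fin (n + 1)) (_ : i ≤ j) (A : cell n),
    deg i.castSucc (deg j A) = deg j.succ (deg i A)
  conn_conn_lt : ∀ {n : ℕ} (i j : Fin (n + 1)) (_ : i < j) (α β : Bool) (A : cell (n + 1)),
    conn i.castSucc α (conn j β A) = conn j.succ β (conn i α A)
  conn_conn_self : ∀ {n : ℕ} (i : Fin (n + 1)) (α : Bool) (A : cell (n + 1)),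
    conn i.castSucc α (conn i α A) = conn i.succ α (conn i α A)
  conn_deg_self : ∀ {n : ℕ} (i : Fin (n + 1)) (α : Bool) (A : cell n),
    conn i α (deg i A) = deg i.castSucc (deg i A)
  conn_deg_lt : ∀ {n : ℕ} (i j : Fin (n + 1)) (_ : i ≤ j) (α : Bool) (A : cell (n + 1)),
    conn i.castSucc α (deg j.succ A) = deg j.succ.succ (conn i α A)
  conn_deg_gt : ∀ {n : ℕ} (i j : Fin (n + 1)) (_ : j ≤ i) (α : Bool) (A : cell (n + 1)),
    conn i.succ α (deg j.castSucc A) = deg j.castSucc.castSucc (conn i α A)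
  face_comp_neg : ∀ {n : ℕ} (i : Fin (n + 1)) (A B : cell (n + 1)) (h),
    face i false (comp i A B h) = face i false A
  face_comp_pos : ∀ {n : ℕ} (i : Fin (n + 1)) (A B : cell (n + 1)) (h),
    face i true (comp i A B h) = face i true B
  face_comp_lt : ∀ {n : ℕ} (i j : Fin (n + 1)) (_ : i ≤ j) (α : Bool) (A B : cell (n + 2)) (h h'),
    face i.castSucc α (comp j.succ A B h) =
      comp j (face i.castSucc α A) (face i.castSucc α B) h'
  face_comp_gt : ∀ {n : ℕ} (i j : Fin (n + 1)) (_ : i ≤ j) (α : Bool) (A B : cell (n + 2)) (h h'),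
    face j.succ α (comp i.castSucc A B h) =
      comp i (face j.succ α A) (face j.succ α B) h'
  comp_comp_comp_comp : ∀ {n : ℕ} (i j : Fin (n + 1)) (_ : i ≠ j) (A B C D : cell (n + 1))
    (h₁ h₂ h₃ h₄ h₅ h₆),
    comp j (comp i A B h₁) (comp i C D h₂) h₃ = comp i (comp j A C h₄) (comp j B D h₅) h₆
  comp_assoc : ∀ {n : ℕ} (i : Fin (n + 1)) (A B C : cell (n + 1)) (h₁ h₂ h₃ h₄),
    comp i A (comp i B C h₁) h₂ = comp i (comp i A B h₃) C h₄
  comp_deg : ∀ {n : ℕ} (i : Fin (n + 1)) (A : cell (n + 1)) (h),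
    comp i A (deg i (face i true A)) h = A
  deg_comp : ∀ {n : ℕ} (i : Fin (n + 1)) (A : cell (n + 1)) (h),
    comp i (deg i (face i false A)) A h = A
  deg_comp_le : ∀ {n : ℕ} (i j : Fin (n + 1)) (_ : i ≤ j) (A B : cell (n + 1)) (h h'),
    deg i.castSucc (comp j A B h) = comp j.succ (deg i.castSucc A) (deg i.castSucc B) h'
  deg_comp_gt : ∀ {n : ℕ} (i j : Fin (n + 1)) (_ : j ≤ i) (A B : cell (n + 1)) (h h'),
    deg i.succ (comp j A B h) = comp j.castSucc (deg i.succ A) (deg i.succ B) h'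
  conn_comp_conn_castSucc : ∀ {n : ℕ} (i : Fin (n + 1)) (A : cell (n + 1)) (h),
    comp i.castSucc (conn i true A) (conn i false A) h = deg i.succ A
  conn_comp_conn_succ : ∀ {n : ℕ} (i : Fin (n + 1)) (A : cell (n + 1)) (h),
    comp i.succ (conn i true A) (conn i false A) h = deg i.castSucc A
  conn_comp_lt : ∀ {n : ℕ} (i j : Fin (n + 1)) (_ : i ≤ j) (α : Bool) (A B : cell (n + 2)) (h h'),
    conn i.castSucc α (comp j.succ A B h) =
      comp j.succ.succ (conn i.castSucc α A) (conn i.castSucc α B) h'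
  conn_comp_gt : ∀ {n : ℕ} (i j : Fin (n + 1)) (_ : i ≤ j) (α : Bool) (A B : cell (n + 2)) (h h'),
    conn j.succ α (comp i.castSucc A B h) =
      comp i.castSucc.castSucc (conn j.succ α A) (conn j.succ α B) h'
  conn_neg_comp : ∀ {n : ℕ} (i : Fin (n + 1)) (A B : cell (n + 1)) (h h₁ h₂ h₃),
    conn i false (comp i A B h) =
      comp i.succ (comp i.castSucc (conn i false A) (deg i.succ B) h₁)
        (comp i.castSucc (deg i.castSucc B) (conn i false B) h₂) h₃
  conn_pos_comp : ∀ {n : ℕ} (i : Fin (n + 1)) (A B : cell (n + 1)) (h h₁ h₂ h₃),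
    conn i true (comp i A B h) =
      comp i.succ (comp i.castSucc (conn i true A) (deg i.castSucc A) h₁)
        (comp i.castSucc (deg i.succ A) (conn i true B) h₂) h₃

namespace CubicalOmegaCategory

variable (X : CubicalOmegaCategory.{u})

/-- `B` is an `Rᵢ`-inverse of `A`. -/
def IsRInverse {n : ℕ} (i : Fin (n + 1)) (A B : X.cell (n + 1)) : Prop :=
  (∃ h, X.comp i A B h = X.deg i (X.face i false A)) ∧
    ∃ h, X.comp i B A h = X.deg i (X.face i true A)

/-- `A` is `Rᵢ`-invertible. -/
def RInvertible {n : ℕ} (i : Fin (n + 1)) (A : X.cell (n + 1)) : Prop :=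
  ∃ B, X.IsRInverse i A B

/-- The equation `(Γᵢ⁺ ∂ᵢ⁻B ⋆ᵢ B) ⋆ᵢ₊₁ (A ⋆ᵢ Γᵢ⁻ ∂ᵢ⁺A) = Γᵢ⁻ ∂ᵢ⁻A ⋆ᵢ Γᵢ⁺ ∂ᵢ⁺B`. -/
def TEquation {n : ℕ} (i : Fin (n + 1)) (A B : X.cell (n + 2)) : Prop :=
  ∃ h₁ h₂ h₃ h₄,
    X.comp i.succ
        (X.comp i.castSucc (X.conn i true (X.face i.castSucc false B)) B h₁)
        (X.comp i.castSucc A (X.conn i false (X.face i.castSucc true A)) h₂) h₃ =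
      X.comp i.castSucc (X.conn i false (X.face i.castSucc false A))
        (X.conn i true (X.face i.castSucc true B)) h₄

/-- `B` is a `Tᵢ`-inverse of `A`. -/
def IsTInverse {n : ℕ} (i : Fin (n + 1)) (A B : X.cell (n + 2)) : Prop :=
  (∀ α, X.face i.castSucc α A = X.face i.succ α B) ∧
    (∀ α, X.face i.succ α A = X.face i.castSucc α B) ∧
      X.TEquation i A B ∧ X.TEquation i B A

/-- `A` is `Tᵢ`-invertible. -/
def TInvertible {n : ℕ} (i : Fin (n + 1)) (A : X.cell (n + 2)) : Prop :=
  ∃ B, X.IsTInverse i A B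

/-- The folding operation `ψᵢ A = Γᵢ⁺ ∂ᵢ₊₁⁻ A ⋆ᵢ₊₁ A ⋆ᵢ₊₁ Γᵢ⁻ ∂ᵢ₊₁⁺ A`. An `(n+1)`-cell has the
`n` foldings `ψᵢ` with `i : Fin n`. -/
def psi : ∀ {n : ℕ}, Fin n → X.cell (n + 1) → X.cell (n + 1)
  | 0, _, A => A
  | _ + 1, i, A =>
    X.comp i.succ
      (X.comp i.succ (X.conn i true (X.face i.succ false A)) A (X.face_conn_succ _ _ _))
      (X.conn i false (X.face i.succ true A))
      ((X.face_comp_pos _ _ _ _).trans (X.face_conn_succ _ _ _).symm)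

/-- The composite `ψ₁ (ψ₂ (⋯ (ψₙ A)))` of all foldings of an `(n+1)`-cell `A`. -/
def psiAll {n : ℕ} (A : X.cell (n + 1)) : X.cell (n + 1) :=
  (List.finRange n).foldr (fun i B => X.psi i B) A

/-- An `(n+1)`-cell `A` is (plainly) invertible if `ψ₁ ⋯ ψₙ A` is `R₁`-invertible. -/
def Invertible {n : ℕ} (A : X.cell (n + 1)) : Prop :=
  X.RInvertible 0 (X.psiAll A)

/-- `X` is a cubical `(ω,p)`-category: all cells of dimension `> p` are invertible. -/
def IsOmegaP (p : ℕ∞) : Prop :=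
  ∀ n : ℕ, p < ((n + 1 : ℕ) : ℕ∞) → ∀ A : X.cell (n + 1), X.Invertible A

end CubicalOmegaCategory

/-- An augmented directed complex. -/
structure ADC where
  /-- the chain groups -/
  X : ℕ → Type u
  [grp : ∀ n, AddCommGroup (X n)]
  /-- the differential -/
  d : ∀ n, X (n + 1) →+ X n
  /-- the augmentation -/
  e : X 0 →+ ℤ
  d_d : ∀ n x, d n (d (n + 1) x) = 0
  e_d : ∀ x, e (d 0 x) = 0
  /-- the distinguished submonoids -/
  pos : ∀ n, AddSubmonoid (X n)

attribute [instance] ADC.grp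

namespace ADC

/-- A morphism of augmented directed complexes. -/
@[ext] structure Hom (K : ADC.{u}) (L : ADC.{v}) where
  /-- the components -/
  map : ∀ n, K.X n →+ L.X n
  d_map : ∀ n x, L.d n (map (n + 1) x) = map n (K.d n x)
  e_map : ∀ x, L.e (map 0 x) = K.e x
  map_pos : ∀ n, ∀ x ∈ K.pos n, map n x ∈ L.pos n

/-- Composition of morphisms (first `f`, then `g`). -/
def Hom.comp {K : ADC.{u}} {L : ADC.{v}} {M : ADC.{w}} (g : Hom L M) (f : Hom K L) : Hom K M where
  map n := (g.map n).comp (f.map n)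
  d_map n x := by simp [g.d_map, f.d_map]
  e_map x := by simp [g.e_map, f.e_map]
  map_pos n x hx := g.map_pos n _ (f.map_pos n x hx)

/-- `x` is an invertible element of the distinguished submonoid in degree `n`. -/
def Invertible (K : ADC.{u}) {n : ℕ} (x : K.X n) : Prop :=
  x ∈ K.pos n ∧ -x ∈ K.pos n

/-- `K` is an `(ω,p)`-ADC: the distinguished submonoid is everything in degrees `> p`. -/
def IsOmegaP (K : ADC.{u}) (p : ℕ∞) : Prop :=
  ∀ n : ℕ, p < (n : ℕ∞) → K.pos n = ⊤

end ADC

/-- The integer `±1` of a sign. -/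
def sgn (α : Bool) : ℤ := if α then 1 else -1

/-! ### The functor `Z` -/

namespace CubicalOmegaCategory

variable (X : CubicalOmegaCategory.{u})

/-- The elements of `ℤ[Xₙ]` which are made zero in `Z X`:
`[A ⋆ᵢ B] - ([A] + [B])` and `[Γᵢ^α A]`. -/
inductive ZRel : ∀ n : ℕ, FreeAbelianGroup (X.cell n) → Prop
  | comp {n : ℕ} (i : Fin (n + 1)) (A B : X.cell (n + 1)) (h) : ZRel (n + 1)
      (FreeAbelianGroup.of (X.comp i A B h) - (FreeAbelianGroup.of A + FreeAbelianGroup.of B))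
  | conn {n : ℕ} (i : Fin (n + 1)) (α : Bool) (A : X.cell (n + 1)) : ZRel (n + 2)
      (FreeAbelianGroup.of (X.conn i α A))

/-- The group of `n`-chains of `Z X`. -/
abbrev ZGroup (n : ℕ) : Type u :=
  FreeAbelianGroup (X.cell n) ⧸ AddSubgroup.closure {x | X.ZRel n x}

/-- The class `[A]` of a cell. -/
def cls {n : ℕ} (A : X.cell n) : X.ZGroup n :=
  QuotientAddGroup.mk (FreeAbelianGroup.of A)

theorem cls_comp {n : ℕ} (i : Fin (n + 1)) (A B : X.cell (n + 1)) (h) :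
    X.cls (X.comp i A B h) = X.cls A + X.cls B := by
  rw [cls, cls, cls, ← QuotientAddGroup.mk_add, ← sub_eq_zero, ← QuotientAddGroup.mk_sub,
    QuotientAddGroup.eq_zero_iff]
  exact AddSubgroup.subset_closure (ZRel.comp i A B h)

theorem cls_conn {n : ℕ} (i : Fin (n + 1)) (α : Bool) (A : X.cell (n + 1)) :
    X.cls (X.conn i α A) = 0 := by
  rw [cls, QuotientAddGroup.eq_zero_iff]
  exact AddSubgroup.subset_closure (ZRel.conn i α A)

/-- The boundary `∑ α (-1)ⁱ [∂ᵢ^α A]` of a cell (with `i` counted from `1`). -/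
def bdry {n : ℕ} (A : X.cell (n + 1)) : X.ZGroup n :=
  ∑ i : Fin (n + 1), ∑ α : Bool, (sgn α * (-1) ^ (i.val + 1)) • X.cls (X.face i α A)

theorem bdry_comp {n : ℕ} (i : Fin (n + 1)) (A B : X.cell (n + 1)) (h) :
    X.bdry (X.comp i A B h) = X.bdry A + X.bdry B := by
  unfold bdry
  rw [← Finset.sum_add_distrib]
  refine Finset.sum_congr rfl fun j _ => ?_
  rcases lt_trichotomy j i with hj | rfl | hj
  · obtain _ | n := n
    · omega
    obtain ⟨i, rfl⟩ := Fin.exists_succ_eq.2 (Fin.ne_zero_of_lt hj)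
    obtain ⟨j, rfl⟩ := Fin.exists_castSucc_eq.2 (Fin.ne_last_of_lt hj)
    have hij : j ≤ i := Fin.le_castSucc_iff.2 hj |> fun h => by simpa using h
    rw [← Finset.sum_add_distrib]
    refine Finset.sum_congr rfl fun α _ => ?_
    rw [X.face_comp_lt j i hij α A B h
      (by rw [X.face_face j i hij, X.face_face j i hij, h]), cls_comp, smul_add]
  · simp only [Fintype.sum_bool, X.face_comp_neg, X.face_comp_pos, h]
    simp only [sgn, if_true, Bool.false_eq_true, if_false]
    module
  · obtain _ | n := n
    · omega
    obtain ⟨j, rfl⟩ := Fin.exists_succ_eq.2 (Fin.ne_zero_of_lt hj)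
    obtain ⟨i, rfl⟩ := Fin.exists_castSucc_eq.2 (Fin.ne_last_of_lt hj)
    have hij : i ≤ j := Fin.le_castSucc_iff.2 hj |> fun h => by simpa using h
    rw [← Finset.sum_add_distrib]
    refine Finset.sum_congr rfl fun α _ => ?_
    rw [X.face_comp_gt i j hij α A B h
      (by rw [← X.face_face i j hij, ← X.face_face i j hij, h]), cls_comp, smul_add]

theorem bdry_conn {n : ℕ} (i : Fin (n + 1)) (β : Bool) (A : X.cell (n + 1)) :
    X.bdry (X.conn i β A) = 0 := by
  unfold bdry
  have key : ∀ α, X.cls (X.face i.castSucc α (X.conn i β A)) =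
      X.cls (X.face i.succ α (X.conn i β A)) := by
    intro α
    by_cases hα : α = β
    · subst hα
      rw [X.face_conn_castSucc, X.face_conn_succ]
    · obtain rfl : β = !α := by cases α <;> cases β <;> simp_all
      rw [X.face_conn_castSucc_not, X.face_conn_succ_not]
  rw [Finset.sum_eq_add i.castSucc i.succ (by simp [Fin.ext_iff])]
  · simp only [key, Fin.val_castSucc, Fin.val_succ]
    rw [← Finset.sum_add_distrib]
    refine Finset.sum_eq_zero fun α _ => ?_
    rw [← add_smul]
    simp [pow_succ]
  · rintro j - ⟨h1, h2⟩
    refine Finset.sum_eq_zero fun α _ => ?_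
    obtain _ | n := n
    · exfalso
      simp only [ne_eq, Fin.ext_iff, Fin.val_castSucc, Fin.val_succ] at h1 h2
      omega
    suffices h : X.cls (X.face j α (X.conn i β A)) = 0 by rw [h, smul_zero]
    rcases lt_or_ge j i.castSucc with hj | hj
    · obtain ⟨i, rfl⟩ : ∃ i' : Fin (n + 1), i = i'.succ :=
        ⟨⟨i.val - 1, by have := i.2; simp [Fin.lt_def] at hj; omega⟩, by
          ext; simp [Fin.lt_def] at hj ⊢; omega⟩
      obtain ⟨j, rfl⟩ : ∃ j' : Fin (n + 1), j = j'.castSucc.castSucc :=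
        ⟨⟨j.val, by simp [Fin.lt_def] at hj; omega⟩, by ext; simp⟩
      have hji : j ≤ i := by
        simp only [Fin.lt_def, Fin.le_def, Fin.val_castSucc, Fin.val_succ] at hj ⊢
        omega
      rw [X.face_conn_lt j i hji, cls_conn]
    · have hj' : i.val + 1 < j.val := by
        simp only [ne_eq, Fin.ext_iff, Fin.val_castSucc, Fin.val_succ, Fin.le_def] at h1 h2 hj
        omega
      have := j.2
      obtain ⟨i, rfl⟩ : ∃ i' : Fin (n + 1), i = i'.castSucc :=
        ⟨⟨i.val, by omega⟩, by ext; simp⟩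
      obtain ⟨j, rfl⟩ : ∃ j' : Fin (n + 1), j = j'.succ.succ :=
        ⟨⟨j.val - 2, by omega⟩, by ext; simp; omega⟩
      have hij : i ≤ j := by
        simp only [Fin.le_def, Fin.val_castSucc, Fin.val_succ] at hj' ⊢
        omega
      rw [X.face_conn_gt j i hij, cls_conn]
  · simp
  · simp

/-- The differential of `Z X`. -/
def Zd (n : ℕ) : X.ZGroup (n + 1) →+ X.ZGroup n :=
  QuotientAddGroup.lift _ (FreeAbelianGroup.lift X.bdry) (by
    rw [AddSubgroup.closure_le]
    rintro x (⟨i, A, B, h⟩ | ⟨i, α, A⟩)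
    · simp [AddMonoidHom.mem_ker, bdry_comp]
    · simp [AddMonoidHom.mem_ker, bdry_conn])

theorem Zd_cls {n : ℕ} (A : X.cell (n + 1)) : X.Zd n (X.cls A) = X.bdry A := by
  simp [Zd, cls]

theorem ZGroup_induction {n : ℕ} {P : X.ZGroup n → Prop} (x : X.ZGroup n) (h0 : P 0)
    (hc : ∀ A, P (X.cls A)) (hn : ∀ x, P x → P (-x)) (ha : ∀ x y, P x → P y → P (x + y)) :
    P x := by
  induction x using QuotientAddGroup.induction_on with
  | H z =>
    induction z using FreeAbelianGroup.induction_on with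
    | zero => exact h0
    | of A => exact hc A
    | neg A h => exact hn _ h
    | add a b h1 h2 => exact ha _ _ h1 h2

/-- The augmentation of `Z X`, with value `1` on every `0`-cell. -/
def Ze : X.ZGroup 0 →+ ℤ :=
  QuotientAddGroup.lift _ (FreeAbelianGroup.lift fun _ => 1) (by
    rw [AddSubgroup.closure_le]
    rintro x ⟨⟩)

theorem sum_sum_eq_zero {M : Type*} [AddCommGroup M] {n : ℕ} (T : Fin (n + 2) → Fin (n + 1) → M)
    (h : ∀ i j : Fin (n + 1), i ≤ j → T i.castSucc j + T j.succ i = 0) :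
    ∑ i, ∑ j, T i j = 0 := by
  rw [← Fintype.sum_prod_type']
  have key : ∀ (i : Fin (n + 2)) (j : Fin (n + 1)), ∃ b : Fin (n + 2) × Fin (n + 1),
      (i.val ≤ j.val ∧ b.1.val = j.val + 1 ∧ b.2.val = i.val) ∨
        (j.val < i.val ∧ b.1.val = j.val ∧ b.2.val + 1 = i.val) := by
    intro i j
    by_cases hij : i.val ≤ j.val
    · exact ⟨(⟨j + 1, by omega⟩, ⟨i, by omega⟩), Or.inl ⟨hij, rfl, rfl⟩⟩
    · exact ⟨(⟨j, by omega⟩, ⟨i - 1, by omega⟩), Or.inr ⟨by omega, rfl, by simp; omega⟩⟩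
  choose g hg using key
  refine Finset.sum_involution (fun a _ => g a.1 a.2) ?_ ?_ ?_ ?_
  · rintro ⟨i, j⟩ -
    dsimp only
    rcases hg i j with ⟨h1, h2, h3⟩ | ⟨h1, h2, h3⟩
    · have := h ⟨i, by omega⟩ j h1
      convert this using 3
      · ext; rfl
      · ext; exact h2
      · ext; exact h3
    · have := h j ⟨i - 1, by omega⟩ (by simp [Fin.le_def]; omega)
      rw [add_comm]
      convert this using 3
      · ext; simp [h2]
      · ext; simp; omega
      · ext; simp; omega
  · rintro ⟨i, j⟩ - - he
    have h1 := congrArg (fun a => a.1.val) he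
    have h2 := congrArg (fun a => a.2.val) he
    dsimp only at h1 h2
    have := hg i j
    omega
  · intros; simp
  · rintro ⟨i, j⟩ -
    have h1 := hg i j
    have h2 := hg (g i j).1 (g i j).2
    ext
    · dsimp only; omega
    · dsimp only; omega

theorem Zd_bdry {n : ℕ} (A : X.cell (n + 2)) : X.Zd n (X.bdry A) = 0 := by
  have : X.Zd n (X.bdry A) = ∑ i : Fin (n + 2), ∑ j : Fin (n + 1), ∑ α : Bool, ∑ β : Bool,
      ((sgn α * (-1) ^ (i.val + 1)) * (sgn β * (-1) ^ (j.val + 1))) •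
        X.cls (X.face j β (X.face i α A)) := by
    rw [bdry, map_sum]
    refine Finset.sum_congr rfl fun i _ => ?_
    rw [Finset.sum_comm, map_sum]
    refine Finset.sum_congr rfl fun α _ => ?_
    rw [map_zsmul, Zd_cls, bdry, Finset.smul_sum]
    refine Finset.sum_congr rfl fun j _ => ?_
    rw [Finset.smul_sum]
    refine Finset.sum_congr rfl fun β _ => ?_
    rw [smul_smul]
  rw [this]
  refine sum_sum_eq_zero _ fun i j hij => ?_
  rw [Finset.sum_comm, ← Finset.sum_add_distrib]
  refine Finset.sum_eq_zero fun α _ => ?_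
  rw [← Finset.sum_add_distrib]
  refine Finset.sum_eq_zero fun β _ => ?_
  rw [X.face_face i j hij, ← add_smul]
  simp only [Fin.val_castSucc, Fin.val_succ]
  convert zero_smul ℤ _
  ring

/-- The augmented directed complex `Z X` of a cubical `ω`-category `X`. The distinguished
submonoids are generated by the classes of cells (they are the images of the `ℕ[Xₙ]`). -/
def Z : ADC.{u} where
  X := X.ZGroup
  d := X.Zd
  e := X.Ze
  d_d n x := by
    induction x using X.ZGroup_induction with
    | h0 => simp
    | hc A => rw [Zd_cls, Zd_bdry]
    | hn x h => simp [h]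
    | ha x y h1 h2 => simp [h1, h2]
  e_d x := by
    induction x using X.ZGroup_induction with
    | h0 => simp
    | hc A => rw [Zd_cls]; simp [bdry, Ze, cls, sgn]
    | hn x h => simp [h]
    | ha x y h1 h2 => simp [h1, h2]
  pos n := AddSubmonoid.closure (Set.range fun A : X.cell n => X.cls A)

/-- The class `[A]` of an `n`-cell `A` as an element of `Z X`. -/
def zcls {n : ℕ} (A : X.cell n) : X.Z.X n := X.cls A

end CubicalOmegaCategory

/-! ### The augmented directed complexes of cubes -/

/-- Sequences `Fin n → {-, ⊙, +}`: `some false` is `-`, `some true` is `+` and `none` is `⊙`. -/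
abbrev CubeWord (n : ℕ) : Type := Fin n → Option Bool

namespace CubeWord

/-- The number of letters `⊙`. -/
def dim {n : ℕ} (s : CubeWord n) : ℕ := (Finset.univ.filter fun i => s i = none).card

/-- The number of letters `⊙` at a place `≤ i`. -/
def rank {n : ℕ} (s : CubeWord n) (i : Fin n) : ℕ :=
  (Finset.univ.filter fun j => j ≤ i ∧ s j = none).card

/-- `∑ (-1)^r (F s⁺ - F s⁻)`, the sum being over all places `i` with `s i = ⊙`, where `⊙` at
place `i` is the `r`-th letter `⊙` of `s`, and `s^α` is `s` with `α` put at place `i`. -/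
def bdry {M : Type*} [AddCommGroup M] {n : ℕ} (F : CubeWord n → M) (s : CubeWord n) : M :=
  ∑ i : Fin n, (if s i = none then (-1 : ℤ) ^ s.rank i else 0) •
    (F (Function.update s i (some true)) - F (Function.update s i (some false)))

/-- Insert a letter at place `i`. -/
def ins {n : ℕ} (i : Fin (n + 1)) (a : Option Bool) (s : CubeWord n) : CubeWord (n + 1) :=
  Fin.insertNth (α := fun _ => Option Bool) i a s

/-- Delete the letter at place `i`. -/
def del {n : ℕ} (i : Fin (n + 1)) (s : CubeWord (n + 1)) : CubeWord n :=
  fun j => s (i.succAbove j)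

/-- The letters, extended by `⊙` outside of the word. -/
def nat {n : ℕ} (s : CubeWord n) (j : ℕ) : Option Bool := if h : j < n then s ⟨j, h⟩ else none

theorem nat_val {n : ℕ} (s : CubeWord n) (i : Fin n) : s.nat i.val = s i := by simp [nat]

theorem nat_ext {n : ℕ} {s t : CubeWord n} (h : ∀ j < n, s.nat j = t.nat j) : s = t := by
  funext i
  rw [← nat_val s, ← nat_val t, h _ i.2]

@[simp] theorem ins_self {n : ℕ} (i : Fin (n + 1)) (a : Option Bool) (s : CubeWord n) :
    ins i a s i = a := by simp [ins]

@[simp] theorem ins_succAbove {n : ℕ} (i : Fin (n + 1)) (a : Option Bool) (s : CubeWord n)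
    (j : Fin n) : ins i a s (i.succAbove j) = s j := by simp [ins]

theorem nat_ins {n : ℕ} (i : Fin (n + 1)) (a : Option Bool) (s : CubeWord n) (j : ℕ) :
    (ins i a s).nat j = if j < i.val then s.nat j else if j = i.val then a else s.nat (j - 1) := by
  by_cases hj : j < n + 1
  · obtain ⟨j, rfl⟩ : ∃ j' : Fin (n + 1), j = j'.val := ⟨⟨j, hj⟩, rfl⟩
    rw [nat_val]
    rcases Fin.eq_self_or_eq_succAbove i j with rfl | ⟨j, rfl⟩
    · simp
    · rw [ins_succAbove, ← nat_val s]
      rcases lt_or_ge j.castSucc i with h | h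
      · have h' : j.val < i.val := h
        rw [Fin.succAbove_of_castSucc_lt _ _ h]
        simp [h']
      · have h' : i.val ≤ j.val := h
        rw [Fin.succAbove_of_le_castSucc _ _ h, Fin.val_succ, if_neg (by omega),
          if_neg (by omega)]
        simp
  · have := i.2
    rw [if_neg (by omega), if_neg (by omega), nat, nat, dif_neg hj, dif_neg (by omega)]

theorem nat_del {n : ℕ} (i : Fin (n + 1)) (s : CubeWord (n + 1)) (j : ℕ) :
    (del i s).nat j = if j < i.val then s.nat j else s.nat (j + 1) := by
  by_cases hj : j < n
  · obtain ⟨j, rfl⟩ : ∃ j' : Fin n, j = j'.val := ⟨⟨j, hj⟩, rfl⟩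
    rw [nat_val, del, ← nat_val s]
    rcases lt_or_ge j.castSucc i with h | h
    · have h' : j.val < i.val := h
      rw [Fin.succAbove_of_castSucc_lt _ _ h, if_pos h', Fin.val_castSucc]
    · have h' : i.val ≤ j.val := h
      rw [Fin.succAbove_of_le_castSucc _ _ h, Fin.val_succ, if_neg (by omega)]
  · have := i.2
    rw [if_neg (by omega), nat, nat, dif_neg hj, dif_neg (by omega)]

theorem nat_update {n : ℕ} (i : Fin n) (s : CubeWord n) (a : Option Bool) (j : ℕ) :
    nat (Function.update s i a) j = if j = i.val then a else s.nat j := by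
  by_cases hj : j < n
  · obtain ⟨j, rfl⟩ : ∃ j' : Fin n, j = j'.val := ⟨⟨j, hj⟩, rfl⟩
    rw [nat_val, nat_val, Function.update_apply]
    simp [Fin.ext_iff]
  · have := i.2
    rw [if_neg (by omega), nat, nat, dif_neg hj, dif_neg hj]

theorem ins_del {n : ℕ} (i : Fin (n + 1)) (s : CubeWord (n + 1)) (a : Option Bool) :
    ins i a (del i s) = Function.update s i a :=
  nat_ext fun j _ => by simp only [nat_ins, nat_del, nat_update]; grind

theorem exists_ins {n : ℕ} (i : Fin (n + 1)) (s : CubeWord (n + 1)) :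
    ∃ a t, s = ins i a t := ⟨s i, del i s, by rw [ins_del, Function.update_eq_self]⟩

@[simp] theorem del_ins {n : ℕ} (i : Fin (n + 1)) (s : CubeWord n) (a : Option Bool) :
    del i (ins i a s) = s :=
  nat_ext fun j _ => by simp only [nat_ins, nat_del]; grind

@[simp] theorem update_ins_self {n : ℕ} (i : Fin (n + 1)) (s : CubeWord n) (a b : Option Bool) :
    Function.update (ins i a s) i b = ins i b s :=
  nat_ext fun j _ => by simp only [nat_ins, nat_update]; grind

@[simp] theorem update_ins_succAbove {n : ℕ} (i : Fin (n + 1)) (s : CubeWord n)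
    (a b : Option Bool) (j : Fin n) :
    Function.update (ins i a s) (i.succAbove j) b = ins i a (Function.update s j b) := by
  funext x
  rcases Fin.eq_self_or_eq_succAbove i x with rfl | ⟨x, rfl⟩
  · rw [Function.update_of_ne (Fin.succAbove_ne _ _).symm, ins_self, ins_self]
  · rw [ins_succAbove, Function.update_apply, Function.update_apply, ins_succAbove]
    simp

theorem dim_eq_sum {n : ℕ} (s : CubeWord n) : s.dim = ∑ i, if s i = none then 1 else 0 := by
  simp [dim]

theorem rank_eq_sum {n : ℕ} (s : CubeWord n) (i : Fin n) :
    s.rank i = ∑ j, if j ≤ i ∧ s j = none then 1 else 0 := by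
  simp [rank]

theorem dim_ins {n : ℕ} (i : Fin (n + 1)) (a : Option Bool) (s : CubeWord n) :
    (ins i a s).dim = (if a = none then 1 else 0) + s.dim := by
  simp [dim_eq_sum, Fin.sum_univ_succAbove _ i]

theorem rank_ins {n : ℕ} (i : Fin (n + 1)) (a : Option Bool) (s : CubeWord n) (j : Fin n) :
    (ins i a s).rank (i.succAbove j) =
      (if i ≤ i.succAbove j ∧ a = none then 1 else 0) + s.rank j := by
  simp [rank_eq_sum, Fin.sum_univ_succAbove _ i, Fin.succAbove_le_succAbove_iff]

theorem dim_update {n : ℕ} (s : CubeWord n) (i : Fin n) (h : s i = none) (b : Bool) :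
    dim (Function.update s i (some b)) + 1 = s.dim := by
  obtain _ | n := n
  · exact i.elim0
  obtain ⟨a, t, rfl⟩ := exists_ins i s
  rw [ins_self] at h
  subst h
  rw [update_ins_self, dim_ins, dim_ins]
  simp [add_comm]

section bdry

variable {M N : Type*} [AddCommGroup M] [AddCommGroup N]

/-- The coefficients in the boundary. -/
def coef {n : ℕ} (s : CubeWord n) (i : Fin n) : ℤ := if s i = none then (-1 : ℤ) ^ s.rank i else 0

theorem bdry_def {n : ℕ} (F : CubeWord n → M) (s : CubeWord n) : bdry F s = ∑ i, s.coef i •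
    (F (Function.update s i (some true)) - F (Function.update s i (some false))) := rfl

theorem map_bdry {n : ℕ} (f : M →+ N) (F : CubeWord n → M) (s : CubeWord n) :
    f (bdry F s) = bdry (fun t => f (F t)) s := by
  simp [bdry_def, map_sum, map_zsmul, map_sub]

theorem bdry_congr {n : ℕ} {F G : CubeWord n → M} {s : CubeWord n}
    (h : ∀ i α, s i = none → F (Function.update s i (some α)) =
      G (Function.update s i (some α))) : bdry F s = bdry G s := by
  rw [bdry_def, bdry_def]
  refine Finset.sum_congr rfl fun i _ => ?_
  by_cases hi : s i = none
  · rw [h i _ hi, h i _ hi]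
  · simp [coef, hi]

theorem bdry_zero {n : ℕ} (s : CubeWord n) : bdry (fun _ => (0 : M)) s = 0 := by
  simp [bdry_def]

theorem bdry_add {n : ℕ} (F G : CubeWord n → M) (s : CubeWord n) :
    bdry (fun t => F t + G t) s = bdry F s + bdry G s := by
  rw [bdry_def, bdry_def, bdry_def, ← Finset.sum_add_distrib]
  refine Finset.sum_congr rfl fun i _ => ?_
  rw [← smul_add]
  congr 1
  abel

theorem coef_ins {n : ℕ} (i : Fin (n + 1)) (a : Option Bool) (s : CubeWord n) (j : Fin n) :
    (ins i a s).coef (i.succAbove j) =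
      (if i < i.succAbove j ∧ a = none then -1 else 1) * s.coef j := by
  have : (i < i.succAbove j) ↔ i ≤ i.succAbove j :=
    ⟨le_of_lt, fun h => lt_of_le_of_ne h (Fin.succAbove_ne i j).symm⟩
  simp only [coef, ins_succAbove, rank_ins, this]
  split_ifs <;> simp [pow_add]

theorem bdry_ins {n : ℕ} (i : Fin (n + 1)) (a : Option Bool) (s : CubeWord n)
    (F : CubeWord (n + 1) → M) :
    bdry F (ins i a s) =
      (ins i a s).coef i • (F (ins i (some true) s) - F (ins i (some false) s)) +
      ∑ j, ((if i < i.succAbove j ∧ a = none then -1 else 1) * s.coef j) •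
        (F (ins i a (Function.update s j (some true))) -
          F (ins i a (Function.update s j (some false)))) := by
  rw [bdry_def, Fin.sum_univ_succAbove _ i]
  simp only [update_ins_self, coef_ins, update_ins_succAbove]

theorem coef_some {n : ℕ} (i : Fin (n + 1)) (α : Bool) (s : CubeWord n) :
    (ins i (some α) s).coef i = 0 := by
  simp [coef]

theorem bdry_ins_some {n : ℕ} (i : Fin (n + 1)) (α : Bool) (s : CubeWord n)
    (F : CubeWord (n + 1) → M) :
    bdry F (ins i (some α) s) = bdry (fun t => F (ins i (some α) t)) s := by
  rw [bdry_ins, coef_some, bdry_def]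
  simp

theorem coef_update_none {n : ℕ} (s : CubeWord n) (i j : Fin n) (α : Bool)
    (hi : s i = none) (hj : s j = none) (hij : i < j) :
    (coef (Function.update s i (some α)) j = - coef s j) ∧
      (coef (Function.update s j (some α)) i = coef s i) := by
  obtain _ | n := n
  · exact i.elim0
  constructor
  · obtain ⟨a, t, rfl⟩ := exists_ins i s
    obtain ⟨j, rfl⟩ := Fin.exists_succAbove_eq hij.ne'
    rw [ins_self] at hi
    subst hi
    rw [update_ins_self, coef_ins, coef_ins]
    simp [hij]
  · obtain ⟨a, t, rfl⟩ := exists_ins j s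
    obtain ⟨i, rfl⟩ := Fin.exists_succAbove_eq hij.ne
    rw [ins_self] at hj
    subst hj
    rw [update_ins_self, coef_ins, coef_ins]
    simp [hij.not_gt]

theorem bdry_bdry {n : ℕ} (F : CubeWord n → M) (s : CubeWord n) :
    bdry (bdry F) s = 0 := by
  have h : bdry (bdry F) s = ∑ p : Fin n × Fin n, ∑ α : Bool, ∑ β : Bool,
      (sgn α * sgn β * (s.coef p.1 * coef (Function.update s p.1 (some α)) p.2)) •
        F (Function.update (Function.update s p.1 (some α)) p.2 (some β)) := by
    rw [Fintype.sum_prod_type, bdry_def]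
    refine Finset.sum_congr rfl fun i _ => ?_
    rw [bdry_def, bdry_def, ← Finset.sum_sub_distrib, Finset.smul_sum]
    refine Finset.sum_congr rfl fun j _ => ?_
    simp only [Fintype.sum_bool, sgn, if_true, Bool.false_eq_true, if_false]
    module
  rw [h]
  refine Finset.sum_involution (fun p _ => (p.2, p.1)) ?_ ?_ ?_ ?_
  · rintro ⟨i, j⟩ -
    dsimp only
    rw [Finset.sum_comm (γ := Bool), ← Finset.sum_add_distrib]
    refine Finset.sum_eq_zero fun α _ => ?_
    rw [← Finset.sum_add_distrib]
    refine Finset.sum_eq_zero fun β _ => ?_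
    rcases eq_or_ne i j with rfl | hij
    · simp [coef]
    · rw [Function.update_comm hij, ← add_smul]
      convert zero_smul ℤ _
      by_cases hi : s i = none
      · by_cases hj : s j = none
        · rcases lt_or_gt_of_ne hij with hlt | hlt
          · rw [(coef_update_none s i j β hi hj hlt).1, (coef_update_none s i j α hi hj hlt).2]
            ring
          · rw [(coef_update_none s j i α hj hi hlt).1, (coef_update_none s j i β hj hi hlt).2]
            ring
        · have h1 : coef s j = 0 := by simp [coef, hj]
          have h2 : coef (Function.update s i (some β)) j = 0 := by
            simp [coef, Function.update_of_ne hij.symm, hj]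
          rw [h1, h2]
          ring
      · have h1 : coef s i = 0 := by simp [coef, hi]
        have h2 : coef (Function.update s j (some α)) i = 0 := by
          simp [coef, Function.update_of_ne hij, hi]
        rw [h1, h2]
        ring
  · rintro ⟨i, j⟩ - hne he
    obtain rfl : j = i := congrArg Prod.fst he
    apply hne
    simp [coef]
  · intros; simp
  · intros; rfl

end bdry

end CubeWord

/-- The sequences in `{-, ⊙, +}` of length `n` with exactly `k` letters `⊙`. -/
abbrev CubeSet (n k : ℕ) : Type := {s : CubeWord n // s.dim = k}

/-- The basis element `[s]` in degree `k`; by convention `0` if `s` is not of dimension `k`. -/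
def cubeGen {n : ℕ} (k : ℕ) (s : CubeWord n) : FreeAbelianGroup (CubeSet n k) :=
  if h : s.dim = k then FreeAbelianGroup.of ⟨s, h⟩ else 0

theorem cubeGen_val {n k : ℕ} (s : CubeSet n k) : cubeGen k s.1 = FreeAbelianGroup.of s := by
  simp [cubeGen, s.2]

theorem lift_cubeGen {n k : ℕ} {M : Type*} [AddCommGroup M] (F : CubeWord n → M)
    (h : ∀ s : CubeWord n, s.dim ≠ k → F s = 0) (s : CubeWord n) :
    FreeAbelianGroup.lift (fun s : CubeSet n k => F s.1) (cubeGen k s) = F s := by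
  unfold cubeGen
  split_ifs with hs
  · simp
  · rw [map_zero, h s hs]

/-- The differential of the `n`-cube. -/
def cubeD (n k : ℕ) :
    FreeAbelianGroup (CubeSet n (k + 1)) →+ FreeAbelianGroup (CubeSet n k) :=
  FreeAbelianGroup.lift fun s => CubeWord.bdry (cubeGen k) s.1

theorem cubeD_cubeGen (n k : ℕ) (s : CubeWord n) :
    cubeD n k (cubeGen (k + 1) s) = CubeWord.bdry (cubeGen k) s := by
  refine lift_cubeGen (fun s => CubeWord.bdry (cubeGen k) s) (fun s hs => ?_) s
  rw [← CubeWord.bdry_zero s]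
  refine CubeWord.bdry_congr fun i α hi => ?_
  have := CubeWord.dim_update s i hi α
  rw [cubeGen, dif_neg (by omega)]

/-- The augmented directed complex of the `n`-cube: in degree `k` it is free abelian (with the
basis generating the distinguished submonoid) on the sequences in `{-, ⊙, +}` of length `n` with
`k` letters `⊙`. It is the `n`-fold tensor power of the complex of the interval
`d[⊙] = [-] - [+]`, `e[-] = e[+] = 1`. -/
abbrev cube (n : ℕ) : ADC.{0} where
  X k := FreeAbelianGroup (CubeSet n k)
  d k := cubeD n k
  e := FreeAbelianGroup.lift fun _ => 1
  d_d k x := by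
    rw [← AddMonoidHom.comp_apply]
    refine DFunLike.congr_fun (g := 0) (FreeAbelianGroup.lift_ext _ _ fun s => ?_) x
    rw [← cubeGen_val, AddMonoidHom.comp_apply, cubeD_cubeGen, CubeWord.map_bdry]
    simp only [cubeD_cubeGen, CubeWord.bdry_bdry, AddMonoidHom.zero_apply]
  e_d x := by
    rw [← AddMonoidHom.comp_apply]
    refine DFunLike.congr_fun (g := 0) (FreeAbelianGroup.lift_ext _ _ fun s => ?_) x
    rw [← cubeGen_val, AddMonoidHom.comp_apply, cubeD_cubeGen, CubeWord.map_bdry,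
      AddMonoidHom.zero_apply, CubeWord.bdry_def]
    refine Finset.sum_eq_zero fun i _ => ?_
    by_cases hi : s.1 i = none
    · have h1 := CubeWord.dim_update s.1 i hi
      have h2 := s.2
      rw [cubeGen, cubeGen, dif_pos (by have := h1 true; omega),
        dif_pos (by have := h1 false; omega)]
      simp
    · simp [CubeWord.coef, hi]
  pos k := AddSubmonoid.closure (Set.range FreeAbelianGroup.of)

namespace ADC

variable {K : ADC.{u}}

/-- The value `f[s]` of a morphism on a basis element (and `0` in the other degrees). -/
def Hom.ev {n : ℕ} (f : Hom (cube n) K) (k : ℕ) (s : CubeWord n) : K.X k :=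
  f.map k (cubeGen k s)

theorem Hom.ev_val {n k : ℕ} (f : Hom (cube n) K) (s : CubeSet n k) :
    f.ev k s.1 = f.map k (FreeAbelianGroup.of s) := by
  rw [Hom.ev, cubeGen_val]

theorem Hom.ext_ev {n : ℕ} {f g : Hom (cube n) K} (h : ∀ k s, f.ev k s = g.ev k s) : f = g := by
  refine Hom.ext (funext fun k => FreeAbelianGroup.lift_ext _ _ fun s => ?_)
  rw [← Hom.ev_val, ← Hom.ev_val, h]

theorem Hom.d_ev {n : ℕ} (f : Hom (cube n) K) (k : ℕ) (s : CubeWord n) :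
    K.d k (f.ev (k + 1) s) = CubeWord.bdry (f.ev k) s := by
  rw [Hom.ev, f.d_map]
  change f.map k (cubeD n k _) = _
  rw [cubeD_cubeGen, CubeWord.map_bdry]
  rfl

theorem Hom.ev_of_ne {n : ℕ} (f : Hom (cube n) K) (k : ℕ) (s : CubeWord n) (h : s.dim ≠ k) :
    f.ev k s = 0 := by
  rw [Hom.ev, cubeGen, dif_neg h, map_zero]

theorem Hom.e_ev {n : ℕ} (f : Hom (cube n) K) (s : CubeWord n) (h : s.dim = 0) :
    K.e (f.ev 0 s) = 1 := by
  rw [Hom.ev, cubeGen, dif_pos h, f.e_map]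
  exact FreeAbelianGroup.lift_apply_of _ _

theorem Hom.ev_mem {n : ℕ} (f : Hom (cube n) K) (k : ℕ) (s : CubeWord n) :
    f.ev k s ∈ K.pos k := by
  by_cases h : s.dim = k
  · rw [f.ev_val ⟨s, h⟩]
    exact f.map_pos k _ (AddSubmonoid.subset_closure ⟨_, rfl⟩)
  · rw [f.ev_of_ne k s h]
    exact zero_mem _

/-- Morphisms out of a cube, given on the basis. -/
def Hom.mk' {n : ℕ} (F : ∀ k, CubeWord n → K.X k) (h0 : ∀ k s, s.dim ≠ k → F k s = 0)
    (hd : ∀ k s, K.d k (F (k + 1) s) = CubeWord.bdry (F k) s)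
    (he : ∀ s, s.dim = 0 → K.e (F 0 s) = 1) (hp : ∀ k s, F k s ∈ K.pos k) :
    Hom (cube n) K where
  map k := FreeAbelianGroup.lift fun s => F k s.1
  d_map k x := by
    rw [← AddMonoidHom.comp_apply, ← AddMonoidHom.comp_apply]
    refine DFunLike.congr_fun (FreeAbelianGroup.lift_ext _ _ fun s => ?_) x
    rw [AddMonoidHom.comp_apply, FreeAbelianGroup.lift_apply_of, AddMonoidHom.comp_apply, hd]
    change _ = FreeAbelianGroup.lift (fun s : CubeSet n k => F k s.1)
      (cubeD n k (FreeAbelianGroup.of s))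
    rw [← cubeGen_val s, cubeD_cubeGen, CubeWord.map_bdry]
    simp only [lift_cubeGen (F k) (h0 k)]
  e_map x := by
    rw [← AddMonoidHom.comp_apply]
    refine DFunLike.congr_fun (FreeAbelianGroup.lift_ext _ _ fun s => ?_) x
    rw [AddMonoidHom.comp_apply, FreeAbelianGroup.lift_apply_of, he _ s.2]
    exact (FreeAbelianGroup.lift_apply_of (fun _ => (1 : ℤ)) s).symm
  map_pos k x hx := by
    change x ∈ AddSubmonoid.closure _ at hx
    induction hx using AddSubmonoid.closure_induction with
    | mem x hx =>
      obtain ⟨s, rfl⟩ := hx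
      rw [FreeAbelianGroup.lift_apply_of]
      exact hp _ _
    | zero => rw [map_zero]; exact zero_mem _
    | add x y _ _ h1 h2 => rw [map_add]; exact add_mem h1 h2

theorem Hom.ev_mk' {n : ℕ} (F : ∀ k, CubeWord n → K.X k) (h0 hd he hp) (k : ℕ) (s : CubeWord n) :
    (Hom.mk' (K := K) F h0 hd he hp).ev k s = F k s :=
  lift_cubeGen (F k) (h0 k) s

end ADC

/-! ### The functor `N` -/

namespace CubeWord

/-- Merging two letters: `α` is neutral, `-α` absorbs `-α`, and `none` means that the merged letter
is degenerate (of smaller dimension than the pair of letters). -/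
def merge (α : Bool) (x y : Option Bool) : Option (Option Bool) :=
  if x = some α then some y
  else if y = some α then some x
  else if x = some (!α) ∧ y = some (!α) then some (some (!α))
  else none

/-- A partially defined map on words which preserves dimensions and which, extended by zero,
commutes with boundaries. -/
structure IsChain {m n : ℕ} (φ : CubeWord m → Option (CubeWord n)) : Prop where
  dim_eq : ∀ s t, φ s = some t → t.dim = s.dim
  isSome : ∀ s, s.dim = 0 → φ s ≠ none
  bdry_eq : ∀ {M : Type} [AddCommGroup M] (F : CubeWord n → M) (s : CubeWord m),
    (φ s).elim 0 (bdry F) = bdry (fun t => (φ t).elim 0 F) s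

/-- The map on words underlying the coface maps. -/
def faceMap {n : ℕ} (i : Fin (n + 1)) (α : Bool) (s : CubeWord n) : Option (CubeWord (n + 1)) :=
  some (ins i (some α) s)

/-- The map on words underlying the codegeneracy maps. -/
def degMap {n : ℕ} (i : Fin (n + 1)) (s : CubeWord (n + 1)) : Option (CubeWord n) :=
  if s i = none then none else some (del i s)

/-- The map on words underlying the coconnection maps: the letters at the places `i` and `i + 1`
are merged. -/
def connMap {n : ℕ} (i : Fin (n + 1)) (α : Bool) (s : CubeWord (n + 2)) :
    Option (CubeWord (n + 1)) :=
  (merge α (s i.castSucc) (s i.succ)).map fun x => Function.update (del i.succ s) i x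

theorem isChain_faceMap {n : ℕ} (i : Fin (n + 1)) (α : Bool) : IsChain (faceMap i α) where
  dim_eq s t h := by
    obtain rfl : ins i (some α) s = t := by simpa [faceMap] using h
    simp [dim_ins]
  isSome s _ := by simp [faceMap]
  bdry_eq F s := by
    simp only [faceMap, Option.elim_some]
    rw [bdry_ins_some]

theorem isChain_degMap {n : ℕ} (i : Fin (n + 1)) : IsChain (degMap (n := n) i) where
  dim_eq s t h := by
    obtain ⟨a, u, rfl⟩ := exists_ins i s
    rw [degMap, ins_self, del_ins] at h
    split_ifs at h with ha
    obtain rfl : u = t := by simpa using h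
    simp [dim_ins, ha]
  isSome s hs := by
    obtain ⟨a, u, rfl⟩ := exists_ins i s
    rw [dim_ins] at hs
    rw [degMap, ins_self]
    split_ifs at hs ⊢ <;> simp at *
  bdry_eq F s := by
    obtain ⟨a, u, rfl⟩ := exists_ins i s
    cases a with
    | none =>
      rw [bdry_ins]
      simp [degMap]
    | some α =>
      rw [bdry_ins_some]
      simp [degMap]

theorem connMap_ins {n : ℕ} (i : Fin (n + 1)) (α : Bool) (y : Option Bool) (u : CubeWord (n + 1)) :
    connMap i α (ins i.succ y u) = (merge α (u i) y).map fun x => Function.update u i x := by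
  have : i.castSucc = i.succ.succAbove i := (Fin.succAbove_succ_self i).symm
  rw [connMap, ins_self, del_ins, this, ins_succAbove]

theorem dim_insert2 {n : ℕ} (i : Fin (n + 1)) (u : CubeWord n) (x y : Option Bool) :
    (ins i.succ y (ins i x u)).dim =
      (if y = none then 1 else 0) + ((if x = none then 1 else 0) + u.dim) := by
  rw [dim_ins, dim_ins]

theorem merge_count {α : Bool} {x y z : Option Bool} (h : merge α x y = some z) :
    (if z = none then 1 else 0) =
      (if y = none then 1 else 0) + (if x = none then 1 else 0) := by
  revert h
  rcases x with _ | _ | _ <;> rcases y with _ | _ | _ <;> rcases z with _ | _ | _ <;>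
    cases α <;> simp [merge]

theorem exists_ins₂ {n : ℕ} (i : Fin (n + 1)) (s : CubeWord (n + 2)) :
    ∃ x y u, s = ins i.succ y (ins i x u) := by
  obtain ⟨y, t, rfl⟩ := exists_ins i.succ s
  obtain ⟨x, u, rfl⟩ := exists_ins i t
  exact ⟨x, y, u, rfl⟩

theorem connMap_ins₂ {n : ℕ} (i : Fin (n + 1)) (α : Bool) (x y : Option Bool) (u : CubeWord n) :
    connMap i α (ins i.succ y (ins i x u)) = (merge α x y).map fun z => ins i z u := by
  rw [connMap_ins, ins_self]
  simp only [update_ins_self]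

theorem coef_pair {n : ℕ} (i : Fin (n + 1)) (u : CubeWord n) :
    ∃ c : ℤ, ∀ x y : Option Bool,
      (ins i x u).coef i = (if x = none then c else 0) ∧
      (ins i.succ y (ins i x u)).coef i.castSucc = (if x = none then c else 0) ∧
      (ins i.succ y (ins i x u)).coef i.succ =
        (if y = none then (if x = none then -c else c) else 0) := by
  refine ⟨(ins i none u).coef i, fun x y => ?_⟩
  have h1 : ∀ x, (ins i x u).coef i = if x = none then (ins i none u).coef i else 0 := by
    intro x
    by_cases hx : x = none
    · subst hx; simp
    · simp [coef, hx]
  have hc : i.castSucc = i.succ.succAbove i := (Fin.succAbove_succ_self i).symm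
  refine ⟨h1 x, ?_, ?_⟩
  · rw [hc, coef_ins, ← hc, h1 x, if_neg, one_mul]
    rintro ⟨h, -⟩
    exact absurd h (by simp [Fin.lt_def])
  · have h2 : ins i.succ y (ins i x u) = ins i.castSucc x (ins i y u) :=
      nat_ext fun j _ => by
        simp only [nat_ins, Fin.val_succ, Fin.val_castSucc]
        grind
    have hs : i.succ = i.castSucc.succAbove i := (Fin.succAbove_castSucc_self i).symm
    rw [h2, hs, coef_ins, ← hs, h1 y]
    have : i.castSucc < i.succ := by simp [Fin.lt_def]
    by_cases hx : x = none <;> by_cases hy : y = none <;> simp [hx, hy, this]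

theorem update_ins₂ {n : ℕ} (i : Fin (n + 1)) (x y : Option Bool) (u : CubeWord n) (j : Fin n)
    (b : Option Bool) :
    Function.update (ins i.succ y (ins i x u)) (i.succ.succAbove (i.succAbove j)) b =
      ins i.succ y (ins i x (Function.update u j b)) := by
  rw [update_ins_succAbove, update_ins_succAbove]

theorem bdry_ins₂ {M : Type*} [AddCommGroup M] {n : ℕ} (i : Fin (n + 1)) (u : CubeWord n) :
    ∃ (c : ℤ) (ε : Fin n → ℤ), ∀ x y : Option Bool,
      (∀ F : CubeWord (n + 1) → M, bdry F (ins i x u) =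
        (if x = none then c else 0) • (F (ins i (some true) u) - F (ins i (some false) u)) +
        ∑ j, ((if x = none then ε j else 1) * u.coef j) •
          (F (ins i x (Function.update u j (some true))) -
            F (ins i x (Function.update u j (some false))))) ∧
      (∀ F : CubeWord (n + 2) → M, bdry F (ins i.succ y (ins i x u)) =
        (if x = none then c else 0) • (F (ins i.succ y (ins i (some true) u)) -
          F (ins i.succ y (ins i (some false) u))) +
        (if y = none then (if x = none then -c else c) else 0) •
          (F (ins i.succ (some true) (ins i x u)) - F (ins i.succ (some false) (ins i x u))) +
        ∑ j, ((if y = none then ε j else 1) * ((if x = none then ε j else 1) * u.coef j)) •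
          (F (ins i.succ y (ins i x (Function.update u j (some true)))) -
            F (ins i.succ y (ins i x (Function.update u j (some false)))))) := by
  obtain ⟨c, hc⟩ := coef_pair i u
  refine ⟨c, fun j => if i < i.succAbove j then -1 else 1, fun x y => ⟨fun F => ?_, fun F => ?_⟩⟩
  · rw [bdry_ins, (hc x y).1]
    congr 1
    refine Finset.sum_congr rfl fun j _ => ?_
    congr 2
    by_cases hx : x = none <;> simp [hx]
  · have hi : i.succ.succAbove i = i.castSucc := Fin.succAbove_succ_self i
    have hj : ∀ j, (i.succ < i.succ.succAbove (i.succAbove j)) ↔ i < i.succAbove j := by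
      intro j
      rw [Fin.lt_succAbove_iff_le_castSucc, Fin.lt_succAbove_iff_le_castSucc]
      have := Fin.succAbove_ne i j
      simp only [Fin.le_def, Fin.val_castSucc, Fin.val_succ]
      rcases lt_or_ge j.castSucc i with h | h
      · have h' : j.val < i.val := h
        rw [Fin.succAbove_of_castSucc_lt _ _ h]
        simp only [Fin.val_castSucc]
        omega
      · have h' : i.val ≤ j.val := h
        rw [Fin.succAbove_of_le_castSucc _ _ h, Fin.val_succ]
        omega
    rw [bdry_def, Fin.sum_univ_succAbove _ i.succ, Fin.sum_univ_succAbove _ i, hi, (hc x y).2.1,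
      (hc x y).2.2]
    simp only [update_ins_self, update_ins₂]
    rw [← hi]
    simp only [update_ins_self, update_ins_succAbove]
    rw [← add_assoc, add_comm ((if y = none then _ else _) • _)]
    congr 1
    refine Finset.sum_congr rfl fun j _ => ?_
    rw [coef_ins, coef_ins]
    congr 2
    · simp only [hj]
      by_cases hy : y = none <;> simp [hy]
    · by_cases hx : x = none <;> simp [hx]

theorem isChain_connMap {n : ℕ} (i : Fin (n + 1)) (α : Bool) : IsChain (connMap i α) where
  dim_eq s t h := by
    obtain ⟨x, y, u, rfl⟩ := exists_ins₂ i s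
    rw [connMap_ins₂] at h
    rcases hz : merge α x y with _ | z
    · simp [hz] at h
    · obtain rfl : ins i z u = t := by simpa [hz] using h
      have := merge_count hz
      rw [dim_ins, dim_ins, dim_ins]
      omega
  isSome s hs := by
    obtain ⟨x, y, u, rfl⟩ := exists_ins₂ i s
    rw [connMap_ins₂]
    rw [dim_ins, dim_ins] at hs
    rcases x with _ | _ | _ <;> rcases y with _ | _ | _ <;> cases α <;> simp [merge] at *
  bdry_eq {M} _ F s := by
    obtain ⟨x, y, u, rfl⟩ := exists_ins₂ i s
    obtain ⟨c, ε, h⟩ := bdry_ins₂ (M := M) i u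
    rw [(h x y).2]
    simp only [connMap_ins₂]
    rcases x with _ | _ | _ <;> rcases y with _ | _ | _ <;> cases α <;>
      simp [merge, (h _ none).1]

end CubeWord

namespace ADC

/-- The morphism of cubes induced by a map on words: `[s] ↦ [φ s]`, or `0` if `φ s` is undefined. -/
def cubeMap {m n : ℕ} (φ : CubeWord m → Option (CubeWord n)) (h : CubeWord.IsChain φ) :
    Hom (cube m) (cube n) :=
  Hom.mk' (fun k s => (φ s).elim 0 (cubeGen k))
    (fun k s hs => by
      rcases hφ : φ s with _ | t
      · simp
      · rw [Option.elim_some, cubeGen, dif_neg (by rw [h.dim_eq s t hφ]; exact hs)])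
    (fun k s => by
      rw [← h.bdry_eq]
      rcases hφ : φ s with _ | t
      · simp
      · rw [Option.elim_some, Option.elim_some]
        exact cubeD_cubeGen n k t)
    (fun s hs => by
      obtain ⟨t, ht⟩ := Option.ne_none_iff_exists'.1 (h.isSome s hs)
      rw [ht, Option.elim_some, cubeGen, dif_pos ((h.dim_eq s t ht).trans hs)]
      exact FreeAbelianGroup.lift_apply_of _ _)
    (fun k s => by
      rcases hφ : φ s with _ | t
      · exact zero_mem _
      · rw [Option.elim_some, cubeGen]
        split_ifs with ht
        · exact AddSubmonoid.subset_closure ⟨_, rfl⟩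
        · exact zero_mem _)

variable {K : ADC.{u}}

theorem Hom.ev_comp_cubeMap {m n : ℕ} (φ : CubeWord m → Option (CubeWord n))
    (h : CubeWord.IsChain φ) (f : Hom (cube n) K) (k : ℕ) (s : CubeWord m) :
    (f.comp (cubeMap φ h)).ev k s = (φ s).elim 0 (f.ev k) := by
  change f.map k ((cubeMap φ h).ev k s) = _
  rw [cubeMap, Hom.ev_mk']
  rcases φ s with _ | t
  · simp
  · rfl

/-- The faces of `N K`. -/
def nFace {n : ℕ} (i : Fin (n + 1)) (α : Bool) (f : Hom (cube (n + 1)) K) : Hom (cube n) K :=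
  f.comp (cubeMap _ (CubeWord.isChain_faceMap i α))

/-- The degeneracies of `N K`. -/
def nDeg {n : ℕ} (i : Fin (n + 1)) (f : Hom (cube n) K) : Hom (cube (n + 1)) K :=
  f.comp (cubeMap _ (CubeWord.isChain_degMap i))

/-- The connections of `N K`. -/
def nConn {n : ℕ} (i : Fin (n + 1)) (α : Bool) (f : Hom (cube (n + 1)) K) :
    Hom (cube (n + 2)) K :=
  f.comp (cubeMap _ (CubeWord.isChain_connMap i α))

theorem ev_nFace {n : ℕ} (i : Fin (n + 1)) (α : Bool) (f : Hom (cube (n + 1)) K) (k : ℕ)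
    (s : CubeWord n) : (nFace i α f).ev k s = f.ev k (s.ins i (some α)) := by
  rw [nFace, Hom.ev_comp_cubeMap]
  rfl

theorem ev_nDeg {n : ℕ} (i : Fin (n + 1)) (f : Hom (cube n) K) (k : ℕ)
    (s : CubeWord (n + 1)) :
    (nDeg i f).ev k s = if s.nat i.val = none then 0 else f.ev k (s.del i) := by
  rw [nDeg, Hom.ev_comp_cubeMap, CubeWord.degMap, CubeWord.nat_val]
  split_ifs <;> rfl

theorem ev_nConn {n : ℕ} (i : Fin (n + 1)) (α : Bool) (f : Hom (cube (n + 1)) K) (k : ℕ)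
    (s : CubeWord (n + 2)) :
    (nConn i α f).ev k s = (CubeWord.merge α (s.nat i.val) (s.nat (i.val + 1))).elim 0
      fun x => f.ev k (Function.update (s.del i.succ) i x) := by
  have h : s.nat (i.val + 1) = s i.succ := s.nat_val i.succ
  have h' : s.nat i.val = s i.castSucc := s.nat_val i.castSucc
  rw [nConn, Hom.ev_comp_cubeMap, CubeWord.connMap, h, h']
  rcases CubeWord.merge α (s i.castSucc) (s i.succ) with _ | x <;> rfl

theorem ev_of_nFace_eq {n : ℕ} {i : Fin (n + 1)} {f g : Hom (cube (n + 1)) K}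
    (h : nFace i true f = nFace i false g) (k : ℕ) (s : CubeWord n) :
    f.ev k (s.ins i (some true)) = g.ev k (s.ins i (some false)) := by
  rw [← ev_nFace, ← ev_nFace, h]

/-- The values on the basis of the composite of `f` and `g` in direction `i`: at a sequence `s`, it
is `f[s] + g[s]`, `f[s]` or `g[s]`, according to whether `s i` is `⊙`, `-` or `+`. (The cocomposition
maps the interval to two intervals glued end to end: `⊙` goes to the sum of the two copies of `⊙`,
`-` to the first copy of `-` and `+` to the second copy of `+`.) -/
def compVal {n : ℕ} (i : Fin (n + 1)) (f g : Hom (cube (n + 1)) K) (k : ℕ)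
    (s : CubeWord (n + 1)) : K.X k :=
  match s i with
  | none => f.ev k s + g.ev k s
  | some false => f.ev k s
  | some true => g.ev k s

theorem compVal_ins {n : ℕ} (i : Fin (n + 1)) (f g : Hom (cube (n + 1)) K) (k : ℕ)
    (a : Option Bool) (s : CubeWord n) : compVal i f g k (s.ins i a) =
      match a with
      | none => f.ev k (s.ins i a) + g.ev k (s.ins i a)
      | some false => f.ev k (s.ins i a)
      | some true => g.ev k (s.ins i a) := by
  rw [compVal, CubeWord.ins_self]

/-- The composition of `N K`. -/
def nComp {n : ℕ} (i : Fin (n + 1)) (f g : Hom (cube (n + 1)) K)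
    (h : nFace i true f = nFace i false g) : Hom (cube (n + 1)) K :=
  Hom.mk' (compVal i f g)
    (fun k s hs => by
      unfold compVal
      rw [f.ev_of_ne k s hs, g.ev_of_ne k s hs]
      split <;> simp)
    (fun k s => by
      obtain ⟨a, u, rfl⟩ := CubeWord.exists_ins i s
      rcases a with _ | _ | _
      · simp only [compVal_ins]
        rw [map_add, f.d_ev, g.d_ev, CubeWord.bdry_ins, CubeWord.bdry_ins, CubeWord.bdry_ins]
        simp only [compVal_ins, ev_of_nFace_eq h, add_sub_add_comm, smul_add,
          Finset.sum_add_distrib]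
        module
      · simp only [compVal_ins]
        rw [f.d_ev, CubeWord.bdry_ins_some, CubeWord.bdry_ins_some]
        simp only [compVal_ins]
      · simp only [compVal_ins]
        rw [g.d_ev, CubeWord.bdry_ins_some, CubeWord.bdry_ins_some]
        simp only [compVal_ins])
    (fun s hs => by
      obtain ⟨a, u, rfl⟩ := CubeWord.exists_ins i s
      rw [compVal_ins]
      rcases a with _ | _ | _
      · simp [CubeWord.dim_ins] at hs
      · exact f.e_ev _ hs
      · exact g.e_ev _ hs)
    (fun k s => by
      unfold compVal
      split
      · exact add_mem (f.ev_mem k s) (g.ev_mem k s)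
      · exact f.ev_mem k s
      · exact g.ev_mem k s)

theorem ev_nComp {n : ℕ} (i : Fin (n + 1)) (f g : Hom (cube (n + 1)) K)
    (h : nFace i true f = nFace i false g) (k : ℕ) (s : CubeWord (n + 1)) :
    (nComp i f g h).ev k s =
      match s.nat i.val with
      | none => f.ev k s + g.ev k s
      | some false => f.ev k s
      | some true => g.ev k s := by
  rw [nComp, Hom.ev_mk', compVal, CubeWord.nat_val]

end ADC

namespace ADC

variable {K : ADC.{u}}

theorem Hom.ev_congr {n : ℕ} (f : Hom (cube n) K) (k : ℕ) {s t : CubeWord n}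
    (h : ∀ j < n, s.nat j = t.nat j) : f.ev k s = f.ev k t := by
  rw [CubeWord.nat_ext h]

section axioms

variable {n : ℕ} (i j : Fin (n + 1))

theorem nFace_nFace (h : i ≤ j) (α β : Bool) (A : Hom (cube (n + 2)) K) :
    nFace j α (nFace i.castSucc β A) = nFace i β (nFace j.succ α A) := by
  rw [Fin.le_def] at h
  refine Hom.ext_ev fun k s => ?_
  simp only [ev_nFace]
  refine A.ev_congr k fun x _ => ?_
  simp only [CubeWord.nat_ins, Fin.val_succ, Fin.val_castSucc]
  grind

theorem nFace_nDeg_self (α : Bool) (A : Hom (cube n) K) : nFace i α (nDeg i A) = A := by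
  refine Hom.ext_ev fun k s => ?_
  simp [ev_nFace, ev_nDeg, CubeWord.nat_ins]

theorem nFace_nDeg_lt (h : i ≤ j) (α : Bool) (A : Hom (cube (n + 1)) K) :
    nFace i.castSucc α (nDeg j.succ A) = nDeg j (nFace i α A) := by
  rw [Fin.le_def] at h
  refine Hom.ext_ev fun k s => ?_
  simp only [ev_nFace, ev_nDeg, CubeWord.nat_ins, Fin.val_succ, Fin.val_castSucc]
  simp only [show ¬ j.val + 1 < i.val by omega, show ¬ j.val + 1 = i.val by omega, if_false,
    Nat.add_sub_cancel]
  refine congrArg _ (A.ev_congr k fun x _ => ?_)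
  simp only [CubeWord.nat_ins, CubeWord.nat_del, Fin.val_succ, Fin.val_castSucc]
  grind

theorem nFace_nDeg_gt (h : i ≤ j) (α : Bool) (A : Hom (cube (n + 1)) K) :
    nFace j.succ α (nDeg i.castSucc A) = nDeg i (nFace j α A) := by
  rw [Fin.le_def] at h
  refine Hom.ext_ev fun k s => ?_
  simp only [ev_nFace, ev_nDeg, CubeWord.nat_ins, Fin.val_succ, Fin.val_castSucc]
  simp only [show i.val < j.val + 1 by omega, if_true]
  refine congrArg _ (A.ev_congr k fun x _ => ?_)
  simp only [CubeWord.nat_ins, CubeWord.nat_del, Fin.val_succ, Fin.val_castSucc]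
  grind

theorem nFace_nConn_lt (h : i ≤ j) (α β : Bool) (A : Hom (cube (n + 2)) K) :
    nFace i.castSucc.castSucc α (nConn j.succ β A) = nConn j β (nFace i.castSucc α A) := by
  rw [Fin.le_def] at h
  refine Hom.ext_ev fun k s => ?_
  simp only [ev_nFace, ev_nConn, CubeWord.nat_ins, Fin.val_succ, Fin.val_castSucc]
  rw [if_neg (by omega), if_neg (by omega), if_neg (by omega), if_neg (by omega),
    Nat.add_sub_cancel, Nat.add_sub_cancel]
  refine congrArg _ (funext fun z => A.ev_congr k fun x _ => ?_)
  simp only [CubeWord.nat_ins, CubeWord.nat_del, CubeWord.nat_update, Fin.val_succ,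
    Fin.val_castSucc]
  grind

theorem nFace_nConn_gt (h : j ≤ i) (α β : Bool) (A : Hom (cube (n + 2)) K) :
    nFace i.succ.succ α (nConn j.castSucc β A) = nConn j β (nFace i.succ α A) := by
  rw [Fin.le_def] at h
  refine Hom.ext_ev fun k s => ?_
  simp only [ev_nFace, ev_nConn, CubeWord.nat_ins, Fin.val_succ, Fin.val_castSucc]
  rw [if_pos (by omega), if_pos (by omega)]
  refine congrArg _ (funext fun z => A.ev_congr k fun x _ => ?_)
  simp only [CubeWord.nat_ins, CubeWord.nat_del, CubeWord.nat_update, Fin.val_succ,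
    Fin.val_castSucc]
  grind

theorem nFace_nConn_castSucc (α β : Bool) (A : Hom (cube (n + 1)) K) :
    nFace i.castSucc α (nConn i β A) = if α = β then A else nDeg i (nFace i α A) := by
  refine Hom.ext_ev fun k s => ?_
  have key : ∀ z, A.ev k (Function.update ((s.ins i.castSucc (some α)).del i.succ) i z) =
      A.ev k (Function.update s i z) := fun z => A.ev_congr k fun x _ => by
    simp only [CubeWord.nat_ins, CubeWord.nat_del, CubeWord.nat_update, Fin.val_succ,
      Fin.val_castSucc]
    grind
  simp only [ev_nFace, ev_nConn, CubeWord.nat_ins, Fin.val_castSucc, key]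
  simp only [lt_irrefl, show ¬ i.val + 1 < i.val by omega, show ¬ i.val + 1 = i.val by omega,
    if_true, if_false, Nat.add_sub_cancel]
  split_ifs with h
  · subst h
    simp [CubeWord.merge, CubeWord.nat_val]
  · obtain rfl : β = !α := by cases α <;> cases β <;> simp_all
    rw [ev_nDeg, ev_nFace, CubeWord.nat_val, CubeWord.ins_del]
    rcases hs : s i with _ | a
    · cases α <;> simp [CubeWord.merge]
    · cases α <;> cases a <;> simp [CubeWord.merge]

theorem nFace_nConn_succ (α β : Bool) (A : Hom (cube (n + 1)) K) :
    nFace i.succ α (nConn i β A) = if α = β then A else nDeg i (nFace i α A) := by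
  refine Hom.ext_ev fun k s => ?_
  simp only [ev_nFace, ev_nConn, CubeWord.nat_ins, Fin.val_succ, CubeWord.del_ins]
  simp only [lt_irrefl, show i.val < i.val + 1 by omega, if_true, if_false, CubeWord.nat_val]
  split_ifs with h
  · subst h
    have := Function.update_eq_self i s
    rcases hs : s i with _ | a
    · rw [hs] at this
      simp [CubeWord.merge, this]
    · rw [hs] at this
      cases α <;> cases a <;> simp [CubeWord.merge, this]
  · obtain rfl : β = !α := by cases α <;> cases β <;> simp_all
    rw [ev_nDeg, ev_nFace, CubeWord.nat_val, CubeWord.ins_del]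
    rcases hs : s i with _ | a
    · cases α <;> simp [CubeWord.merge]
    · cases α <;> cases a <;> simp [CubeWord.merge]

theorem nDeg_nDeg (h : i ≤ j) (A : Hom (cube n) K) :
    nDeg i.castSucc (nDeg j A) = nDeg j.succ (nDeg i A) := by
  rw [Fin.le_def] at h
  refine Hom.ext_ev fun k s => ?_
  have key : A.ev k ((s.del i.castSucc).del j) = A.ev k ((s.del j.succ).del i) :=
    A.ev_congr k fun x _ => by
      simp only [CubeWord.nat_del, Fin.val_succ, Fin.val_castSucc]
      grind
  simp only [ev_nDeg, CubeWord.nat_del, Fin.val_castSucc, Fin.val_succ, key]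
  simp only [show ¬ j.val < i.val by omega, show i.val < j.val + 1 by omega, if_true, if_false]
  split_ifs <;> rfl

theorem nConn_nConn_lt (h : i < j) (α β : Bool) (A : Hom (cube (n + 1)) K) :
    nConn i.castSucc α (nConn j β A) = nConn j.succ β (nConn i α A) := by
  rw [Fin.lt_def] at h
  refine Hom.ext_ev fun k s => ?_
  have key : ∀ y z, A.ev k (Function.update (CubeWord.del j.succ (Function.update (s.del i.castSucc.succ) i.castSucc y)) j z) =
      A.ev k (Function.update (CubeWord.del i.succ (Function.update (s.del j.succ.succ) j.succ z)) i y) :=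
    fun y z => A.ev_congr k fun x _ => by
      simp only [CubeWord.nat_del, CubeWord.nat_update, Fin.val_succ, Fin.val_castSucc]
      grind
  simp only [ev_nConn, CubeWord.nat_del, CubeWord.nat_update, Fin.val_castSucc, Fin.val_succ]
  simp only [show ¬ j.val = i.val by omega, show ¬ j.val + 1 = i.val by omega,
    show ¬ j.val < i.val + 1 by omega, show ¬ j.val + 1 < i.val + 1 by omega,
    show ¬ i.val = j.val + 1 by omega, show ¬ i.val + 1 = j.val + 1 by omega,
    show i.val < j.val + 1 + 1 by omega, show i.val + 1 < j.val + 1 + 1 by omega, if_true, if_false]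
  rcases CubeWord.merge α (s.nat i.val) (s.nat (i.val + 1)) with _ | y <;>
    rcases CubeWord.merge β (s.nat (j.val + 1)) (s.nat (j.val + 1 + 1)) with _ | z <;>
    simp [key]

theorem nConn_nConn_self (α : Bool) (A : Hom (cube (n + 1)) K) :
    nConn i.castSucc α (nConn i α A) = nConn i.succ α (nConn i α A) := by
  refine Hom.ext_ev fun k s => ?_
  have key : ∀ y z w, A.ev k (Function.update (CubeWord.del i.succ (Function.update (s.del i.castSucc.succ) i.castSucc y)) i w) =
      A.ev k (Function.update (CubeWord.del i.succ (Function.update (s.del i.succ.succ) i.succ z)) i w) :=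
    fun y z w => A.ev_congr k fun x _ => by
      simp only [CubeWord.nat_del, CubeWord.nat_update, Fin.val_succ, Fin.val_castSucc]
      grind
  simp only [ev_nConn, CubeWord.nat_del, CubeWord.nat_update, Fin.val_castSucc, Fin.val_succ]
  simp only [show ¬ i.val + 1 = i.val by omega, show ¬ i.val + 1 < i.val + 1 by omega,
    show ¬ i.val = i.val + 1 by omega, show i.val < i.val + 1 + 1 by omega, if_true, if_false]
  rcases s.nat i.val with _ | a <;> rcases s.nat (i.val + 1) with _ | b <;>
    rcases s.nat (i.val + 1 + 1) with _ | c <;> cases α <;> (try cases a) <;> (try cases b) <;>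
    (try cases c) <;> simp [CubeWord.merge] <;> exact key _ _ _

theorem nConn_nDeg_self (α : Bool) (A : Hom (cube n) K) :
    nConn i α (nDeg i A) = nDeg i.castSucc (nDeg i A) := by
  refine Hom.ext_ev fun k s => ?_
  have key : ∀ z, A.ev k (CubeWord.del i (Function.update (s.del i.succ) i z)) =
      A.ev k ((s.del i.castSucc).del i) :=
    fun z => A.ev_congr k fun x _ => by
      simp only [CubeWord.nat_del, CubeWord.nat_update, Fin.val_succ, Fin.val_castSucc]
      grind
  simp only [ev_nConn, ev_nDeg, CubeWord.nat_del, CubeWord.nat_update, Fin.val_castSucc, key]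
  simp only [show ¬ i.val < i.val by omega, if_true, if_false]
  rcases s.nat i.val with _ | a <;> rcases s.nat (i.val + 1) with _ | b <;> cases α <;>
    (try cases a) <;> (try cases b) <;> simp [CubeWord.merge]

theorem nConn_nDeg_lt (h : i ≤ j) (α : Bool) (A : Hom (cube (n + 1)) K) :
    nConn i.castSucc α (nDeg j.succ A) = nDeg j.succ.succ (nConn i α A) := by
  rw [Fin.le_def] at h
  refine Hom.ext_ev fun k s => ?_
  have key : ∀ z, A.ev k (CubeWord.del j.succ (Function.update (s.del i.castSucc.succ) i.castSucc z)) =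
      A.ev k (Function.update ((s.del j.succ.succ).del i.succ) i z) :=
    fun z => A.ev_congr k fun x _ => by
      simp only [CubeWord.nat_del, CubeWord.nat_update, Fin.val_succ, Fin.val_castSucc]
      grind
  simp only [ev_nConn, ev_nDeg, CubeWord.nat_del, CubeWord.nat_update, Fin.val_castSucc,
    Fin.val_succ, key]
  simp only [show ¬ j.val + 1 = i.val by omega, show ¬ j.val + 1 < i.val + 1 by omega,
    show i.val < j.val + 1 + 1 by omega, show i.val + 1 < j.val + 1 + 1 by omega, if_true, if_false]
  rcases CubeWord.merge α (s.nat i.val) (s.nat (i.val + 1)) with _ | y <;> simp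

theorem nConn_nDeg_gt (h : j ≤ i) (α : Bool) (A : Hom (cube (n + 1)) K) :
    nConn i.succ α (nDeg j.castSucc A) = nDeg j.castSucc.castSucc (nConn i α A) := by
  rw [Fin.le_def] at h
  refine Hom.ext_ev fun k s => ?_
  have key : ∀ z, A.ev k (CubeWord.del j.castSucc (Function.update (s.del i.succ.succ) i.succ z)) =
      A.ev k (Function.update ((s.del j.castSucc.castSucc).del i.succ) i z) :=
    fun z => A.ev_congr k fun x _ => by
      simp only [CubeWord.nat_del, CubeWord.nat_update, Fin.val_succ, Fin.val_castSucc]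
      grind
  simp only [ev_nConn, ev_nDeg, CubeWord.nat_del, CubeWord.nat_update, Fin.val_castSucc,
    Fin.val_succ, key]
  simp only [show ¬ j.val = i.val + 1 by omega, show ¬ i.val < j.val by omega,
    show ¬ i.val + 1 < j.val by omega, show j.val < i.val + 1 + 1 by omega, if_true, if_false]
  rcases CubeWord.merge α (s.nat (i.val + 1)) (s.nat (i.val + 1 + 1)) with _ | y <;> simp

theorem nFace_nComp_neg (A B : Hom (cube (n + 1)) K) (h) :
    nFace i false (nComp i A B h) = nFace i false A := by
  refine Hom.ext_ev fun k s => ?_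
  simp [ev_nFace, ev_nComp, CubeWord.nat_ins]

theorem nFace_nComp_pos (A B : Hom (cube (n + 1)) K) (h) :
    nFace i true (nComp i A B h) = nFace i true B := by
  refine Hom.ext_ev fun k s => ?_
  simp [ev_nFace, ev_nComp, CubeWord.nat_ins]

theorem nFace_nComp_lt (h : i ≤ j) (α : Bool) (A B : Hom (cube (n + 2)) K) (h₁ h₂) :
    nFace i.castSucc α (nComp j.succ A B h₁) =
      nComp j (nFace i.castSucc α A) (nFace i.castSucc α B) h₂ := by
  rw [Fin.le_def] at h
  refine Hom.ext_ev fun k s => ?_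
  simp only [ev_nFace, ev_nComp, CubeWord.nat_ins, Fin.val_succ, Fin.val_castSucc]
  rw [if_neg (by omega), if_neg (by omega), Nat.add_sub_cancel]

theorem nFace_nComp_gt (h : i ≤ j) (α : Bool) (A B : Hom (cube (n + 2)) K) (h₁ h₂) :
    nFace j.succ α (nComp i.castSucc A B h₁) =
      nComp i (nFace j.succ α A) (nFace j.succ α B) h₂ := by
  rw [Fin.le_def] at h
  refine Hom.ext_ev fun k s => ?_
  simp only [ev_nFace, ev_nComp, CubeWord.nat_ins, Fin.val_succ, Fin.val_castSucc]
  rw [if_pos (by omega)]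

theorem nComp_nComp_nComp_nComp (A B C D : Hom (cube (n + 1)) K) (h₁ h₂ h₃ h₄ h₅ h₆) :
    nComp j (nComp i A B h₁) (nComp i C D h₂) h₃ =
      nComp i (nComp j A C h₄) (nComp j B D h₅) h₆ := by
  refine Hom.ext_ev fun k s => ?_
  simp only [ev_nComp]
  rcases s.nat i.val with _ | _ | _ <;> rcases s.nat j.val with _ | _ | _ <;>
    simp [add_add_add_comm]

theorem nComp_assoc (A B C : Hom (cube (n + 1)) K) (h₁ h₂ h₃ h₄) :
    nComp i A (nComp i B C h₁) h₂ = nComp i (nComp i A B h₃) C h₄ := by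
  refine Hom.ext_ev fun k s => ?_
  simp only [ev_nComp]
  rcases s.nat i.val with _ | _ | _ <;> simp [add_assoc]

theorem ev_nDeg_nFace (α : Bool) (A : Hom (cube (n + 1)) K) (k : ℕ) (s : CubeWord (n + 1)) :
    (nDeg i (nFace i α A)).ev k s =
      if s.nat i.val = none then 0 else A.ev k (Function.update s i (some α)) := by
  rw [ev_nDeg, ev_nFace, CubeWord.ins_del]

theorem nComp_nDeg (A : Hom (cube (n + 1)) K) (h) : nComp i A (nDeg i (nFace i true A)) h = A := by
  refine Hom.ext_ev fun k s => ?_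
  rw [ev_nComp, ev_nDeg_nFace, CubeWord.nat_val]
  have := Function.update_eq_self i s
  rcases hs : s i with _ | _ | _ <;> rw [hs] at this <;> simp [this]

theorem nDeg_nComp (A : Hom (cube (n + 1)) K) (h) :
    nComp i (nDeg i (nFace i false A)) A h = A := by
  refine Hom.ext_ev fun k s => ?_
  rw [ev_nComp, ev_nDeg_nFace, CubeWord.nat_val]
  have := Function.update_eq_self i s
  rcases hs : s i with _ | _ | _ <;> rw [hs] at this <;> simp [this]

theorem nDeg_nComp_le (h : i ≤ j) (A B : Hom (cube (n + 1)) K) (h₁ h₂) :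
    nDeg i.castSucc (nComp j A B h₁) =
      nComp j.succ (nDeg i.castSucc A) (nDeg i.castSucc B) h₂ := by
  rw [Fin.le_def] at h
  refine Hom.ext_ev fun k s => ?_
  simp only [ev_nDeg, ev_nComp, CubeWord.nat_del, Fin.val_succ, Fin.val_castSucc]
  simp only [show ¬ j.val < i.val by omega, if_false]
  by_cases hs : s.nat i.val = none <;> simp only [hs, if_true, if_false] <;>
    rcases s.nat (j.val + 1) with _ | _ | _ <;> simp

theorem nDeg_nComp_gt (h : j ≤ i) (A B : Hom (cube (n + 1)) K) (h₁ h₂) :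
    nDeg i.succ (nComp j A B h₁) = nComp j.castSucc (nDeg i.succ A) (nDeg i.succ B) h₂ := by
  rw [Fin.le_def] at h
  refine Hom.ext_ev fun k s => ?_
  simp only [ev_nDeg, ev_nComp, CubeWord.nat_del, Fin.val_succ, Fin.val_castSucc]
  simp only [show j.val < i.val + 1 by omega, if_true]
  by_cases hs : s.nat (i.val + 1) = none <;> simp only [hs, if_true, if_false] <;>
    rcases s.nat j.val with _ | _ | _ <;> simp

theorem update_del_castSucc (s : CubeWord (n + 2)) (z : Option Bool) :
    Function.update (s.del i.castSucc) i z = Function.update (s.del i.succ) i z :=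
  CubeWord.nat_ext fun x _ => by
    simp only [CubeWord.nat_update, CubeWord.nat_del, Fin.val_succ, Fin.val_castSucc]
    grind

theorem del_castSucc (s : CubeWord (n + 2)) :
    s.del i.castSucc = Function.update (s.del i.succ) i (s.nat (i.val + 1)) :=
  CubeWord.nat_ext fun x _ => by
    simp only [CubeWord.nat_update, CubeWord.nat_del, Fin.val_succ, Fin.val_castSucc]
    grind

theorem del_succ (s : CubeWord (n + 2)) :
    s.del i.succ = Function.update (s.del i.succ) i (s.nat i.val) :=
  CubeWord.nat_ext fun x _ => by
    simp only [CubeWord.nat_update, CubeWord.nat_del, Fin.val_succ]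
    grind

theorem ev_nDeg_castSucc (A : Hom (cube (n + 1)) K) (k : ℕ) (s : CubeWord (n + 2)) :
    (nDeg i.castSucc A).ev k s = if s.nat i.val = none then 0 else
      A.ev k (Function.update (s.del i.succ) i (s.nat (i.val + 1))) := by
  rw [ev_nDeg, del_castSucc, Fin.val_castSucc]

theorem ev_nDeg_succ (A : Hom (cube (n + 1)) K) (k : ℕ) (s : CubeWord (n + 2)) :
    (nDeg i.succ A).ev k s = if s.nat (i.val + 1) = none then 0 else
      A.ev k (Function.update (s.del i.succ) i (s.nat i.val)) := by
  rw [ev_nDeg, ← del_succ, Fin.val_succ]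

theorem nConn_nComp_nConn_castSucc (A : Hom (cube (n + 1)) K) (h) :
    nComp i.castSucc (nConn i true A) (nConn i false A) h = nDeg i.succ A := by
  refine Hom.ext_ev fun k s => ?_
  rw [ev_nComp, ev_nDeg_succ, ev_nConn, ev_nConn, Fin.val_castSucc]
  rcases s.nat i.val with _ | _ | _ <;> rcases s.nat (i.val + 1) with _ | _ | _ <;>
    simp [CubeWord.merge]

theorem nConn_nComp_nConn_succ (A : Hom (cube (n + 1)) K) (h) :
    nComp i.succ (nConn i true A) (nConn i false A) h = nDeg i.castSucc A := by
  refine Hom.ext_ev fun k s => ?_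
  rw [ev_nComp, ev_nDeg_castSucc, ev_nConn, ev_nConn, Fin.val_succ]
  rcases s.nat i.val with _ | _ | _ <;> rcases s.nat (i.val + 1) with _ | _ | _ <;>
    simp [CubeWord.merge]

theorem nConn_nComp_lt (h : i ≤ j) (α : Bool) (A B : Hom (cube (n + 2)) K) (h₁ h₂) :
    nConn i.castSucc α (nComp j.succ A B h₁) =
      nComp j.succ.succ (nConn i.castSucc α A) (nConn i.castSucc α B) h₂ := by
  rw [Fin.le_def] at h
  refine Hom.ext_ev fun k s => ?_
  simp only [ev_nConn, ev_nComp, CubeWord.nat_update, CubeWord.nat_del, Fin.val_succ,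
    Fin.val_castSucc]
  simp only [show ¬ j.val + 1 = i.val by omega, show ¬ j.val + 1 < i.val + 1 by omega, if_false]
  rcases CubeWord.merge α (s.nat i.val) (s.nat (i.val + 1)) with _ | z <;>
    rcases s.nat (j.val + 1 + 1) with _ | _ | _ <;> simp

theorem nConn_nComp_gt (h : i ≤ j) (α : Bool) (A B : Hom (cube (n + 2)) K) (h₁ h₂) :
    nConn j.succ α (nComp i.castSucc A B h₁) =
      nComp i.castSucc.castSucc (nConn j.succ α A) (nConn j.succ α B) h₂ := by
  rw [Fin.le_def] at h
  refine Hom.ext_ev fun k s => ?_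
  simp only [ev_nConn, ev_nComp, CubeWord.nat_update, CubeWord.nat_del, Fin.val_succ,
    Fin.val_castSucc]
  simp only [show ¬ i.val = j.val + 1 by omega, show i.val < j.val + 1 + 1 by omega, if_true,
    if_false]
  rcases CubeWord.merge α (s.nat (j.val + 1)) (s.nat (j.val + 1 + 1)) with _ | z <;>
    rcases s.nat i.val with _ | _ | _ <;> simp

theorem nConn_neg_nComp (A B : Hom (cube (n + 1)) K) (h h₁ h₂ h₃) :
    nConn i false (nComp i A B h) =
      nComp i.succ (nComp i.castSucc (nConn i false A) (nDeg i.succ B) h₁)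
        (nComp i.castSucc (nDeg i.castSucc B) (nConn i false B) h₂) h₃ := by
  refine Hom.ext_ev fun k s => ?_
  simp only [ev_nConn, ev_nComp, ev_nDeg_castSucc, ev_nDeg_succ, CubeWord.nat_update,
    Fin.val_succ, Fin.val_castSucc, if_true]
  rcases s.nat i.val with _ | _ | _ <;> rcases s.nat (i.val + 1) with _ | _ | _ <;>
    simp [CubeWord.merge]

theorem nConn_pos_nComp (A B : Hom (cube (n + 1)) K) (h h₁ h₂ h₃) :
    nConn i true (nComp i A B h) =
      nComp i.succ (nComp i.castSucc (nConn i true A) (nDeg i.castSucc A) h₁)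
        (nComp i.castSucc (nDeg i.succ A) (nConn i true B) h₂) h₃ := by
  refine Hom.ext_ev fun k s => ?_
  simp only [ev_nConn, ev_nComp, ev_nDeg_castSucc, ev_nDeg_succ, CubeWord.nat_update,
    Fin.val_succ, Fin.val_castSucc, if_true]
  rcases s.nat i.val with _ | _ | _ <;> rcases s.nat (i.val + 1) with _ | _ | _ <;>
    simp [CubeWord.merge]

end axioms

/-- The cubical `ω`-category `N K` of an augmented directed complex `K`: the `n`-cells are the
morphisms from the complex of the `n`-cube to `K`. -/
def N (K : ADC.{u}) : CubicalOmegaCategory.{u} where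
  cell n := Hom (cube n) K
  face := nFace
  deg := nDeg
  conn := nConn
  comp := nComp
  face_face := nFace_nFace
  face_deg_self := nFace_nDeg_self
  face_deg_lt := nFace_nDeg_lt
  face_deg_gt := nFace_nDeg_gt
  face_conn_lt := nFace_nConn_lt
  face_conn_gt := nFace_nConn_gt
  face_conn_castSucc j α A := by rw [nFace_nConn_castSucc, if_pos rfl]
  face_conn_succ j α A := by rw [nFace_nConn_succ, if_pos rfl]
  face_conn_castSucc_not j α A := by rw [nFace_nConn_castSucc, if_neg (by simp)]
  face_conn_succ_not j α A := by rw [nFace_nConn_succ, if_neg (by simp)]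
  deg_deg := nDeg_nDeg
  conn_conn_lt := nConn_nConn_lt
  conn_conn_self := nConn_nConn_self
  conn_deg_self := nConn_nDeg_self
  conn_deg_lt := nConn_nDeg_lt
  conn_deg_gt := nConn_nDeg_gt
  face_comp_neg := nFace_nComp_neg
  face_comp_pos := nFace_nComp_pos
  face_comp_lt := nFace_nComp_lt
  face_comp_gt := nFace_nComp_gt
  comp_comp_comp_comp i j _ := nComp_nComp_nComp_nComp i j
  comp_assoc := nComp_assoc
  comp_deg := nComp_nDeg
  deg_comp := nDeg_nComp
  deg_comp_le := nDeg_nComp_le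
  deg_comp_gt := nDeg_nComp_gt
  conn_comp_conn_castSucc := nConn_nComp_nConn_castSucc
  conn_comp_conn_succ := nConn_nComp_nConn_succ
  conn_comp_lt := nConn_nComp_lt
  conn_comp_gt := nConn_nComp_gt
  conn_neg_comp := nConn_neg_nComp
  conn_pos_comp := nConn_pos_nComp

/-- The value `A[s]` of an `n`-cell `A` of `N K` on a sequence `s` of dimension `k`. -/
def val {K : ADC.{u}} {n k : ℕ} (A : (N K).cell n) (s : CubeSet n k) : K.X k :=
  Hom.map A k (FreeAbelianGroup.of s)

end ADC

namespace CubeSet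

variable {n k : ℕ}

/-- The sequence `Rᵢ s`: the sign of the letter at place `i` is reversed (if it is a sign). -/
def flip (i : Fin n) (s : CubeSet n k) : CubeSet n k :=
  ⟨Function.update s.1 i ((s.1 i).map not), by
    refine Eq.trans (congrArg Finset.card ?_) s.2
    ext j
    by_cases hj : j = i
    · subst hj; simp
    · simp [hj]⟩

/-- The sequence `s ∘ τᵢ`: the letters at the places `i` and `i + 1` are exchanged. -/
def swap (i : Fin n) (s : CubeSet (n + 1) k) : CubeSet (n + 1) k :=
  ⟨s.1 ∘ Equiv.swap i.castSucc i.succ, by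
    refine Eq.trans ?_ s.2
    rw [CubeWord.dim_eq_sum, CubeWord.dim_eq_sum]
    exact Equiv.sum_comp (Equiv.swap i.castSucc i.succ) fun j => if s.1 j = none then 1 else 0⟩

end CubeSet

/-! In `Z X` every connection has class zero by definition, and every degenerate cell has class zero
because it is its own composite with itself. Taking classes in the equation that defines an inverse,
of either kind, therefore leaves only `[A] + [B] = 0`, so `-[A] = [B]` is again the class of a cell.
Foldings compose a cell with connections only, so they do not change its class: if `ψ₁ ⋯ ψₙ A` is
`R₁`-invertible then `[A]` itself is invertible. Invertible elements form a subgroup and the classes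
of cells generate `Z X`, which gives the statement on `(ω,p)`-ADCs.

For `N K`, a cell is a family of values on words, and each equation between cells is checked word by
word. The formula for the `Rᵢ`-inverse reverses the interval at place `i`; the one for the
`Tᵢ`-inverse exchanges two tensor factors, the sign at `⊙⊙` being the sign of the exchange. Both
formulas commute with boundaries and augmentations for every `A`. Invertibility of values is needed
only for positivity, at the words where a minus sign appears (`nFlip`, `nSwap`). Conversely, the
face conditions together with one of the two defining equations determine every value of an inverse
(`ev_of_isRInverse`, `ev_of_isTInverse`), so the formula describes the only inverse.

The statement on cubical `(ω,p)`-categories rests on `ev_psiAll`: the folded cell `ψ₁ ⋯ ψₙ A`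
vanishes on every word that starts with `⊙`, except on the word made of `⊙` alone. The value there
lies in a degree `> p`, where all elements of `K` are invertible, so the criterion for
`R₁`-invertibility applies to the folded cell. -/

namespace CubicalOmegaCategory

/-! ### Invertible classes in `Z X`. -/

variable (X : CubicalOmegaCategory.{u})

/-- The unit law `comp_deg`, applied to a degenerate cell, says that this cell is idempotent for
`⋆ᵢ`. Its class then equals twice itself. -/
theorem cls_deg {n : ℕ} (i : Fin (n + 1)) (A : X.cell n) : X.cls (X.deg i A) = 0 := by
  have h : X.face i true (X.deg i A) = X.face i false (X.deg i (X.face i true (X.deg i A))) := by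
    simp only [X.face_deg_self]
  have := congrArg X.cls (X.comp_deg i (X.deg i A) h)
  rw [cls_comp, X.face_deg_self] at this
  exact left_eq_add.1 this.symm

/-- Of the three cells composed in a folding, the outer two are connections. -/
theorem cls_psi {n : ℕ} (i : Fin n) (A : X.cell (n + 1)) : X.cls (X.psi i A) = X.cls A := by
  obtain _ | n := n
  · exact i.elim0
  · rw [psi, cls_comp, cls_comp, cls_conn, cls_conn, zero_add, add_zero]

theorem cls_psiAll {n : ℕ} (A : X.cell (n + 1)) : X.cls (X.psiAll A) = X.cls A := by
  rw [psiAll]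
  induction List.finRange n with
  | nil => rfl
  | cons i l ih => rw [List.foldr_cons, cls_psi, ih]

theorem cls_mem_pos {n : ℕ} (A : X.cell n) : X.cls A ∈ X.Z.pos n :=
  AddSubmonoid.subset_closure ⟨A, rfl⟩

/-- The opposite of `[A]` is the class of a cell, and all such classes are distinguished. -/
theorem invertible_zcls_of_add_eq_zero {n : ℕ} {A B : X.cell n} (h : X.cls A + X.cls B = 0) :
    X.Z.Invertible (X.zcls A) :=
  ⟨X.cls_mem_pos A, by
    have : -X.zcls A = X.cls B := neg_eq_of_add_eq_zero_right h
    rw [this]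
    exact X.cls_mem_pos B⟩

theorem RInvertible.invertible_zcls {n : ℕ} {i : Fin (n + 1)} {A : X.cell (n + 1)}
    (h : X.RInvertible i A) : X.Z.Invertible (X.zcls A) := by
  obtain ⟨B, ⟨h₁, h⟩, -⟩ := h
  refine X.invertible_zcls_of_add_eq_zero (B := B) ?_
  rw [← X.cls_comp i A B h₁, h, cls_deg]

/-- All the factors of the `T`-equation other than `A` and `B` are connections. In classes the left
side is `[B] + [A]` and the right side is `0`. -/
theorem TInvertible.invertible_zcls {n : ℕ} {i : Fin (n + 1)} {A : X.cell (n + 2)}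
    (h : X.TInvertible i A) : X.Z.Invertible (X.zcls A) := by
  obtain ⟨B, -, -, ⟨h₁, h₂, h₃, h₄, h⟩, -⟩ := h
  refine X.invertible_zcls_of_add_eq_zero (B := B) ?_
  have := congrArg X.cls h
  simpa only [cls_comp, cls_conn, zero_add, add_zero, add_comm] using this

theorem IsOmegaP.Z {p : ℕ∞} (h : X.IsOmegaP p) : X.Z.IsOmegaP p := by
  intro n hn
  obtain _ | n := n
  -- Degree `0` never satisfies the hypothesis, since no `p` is `< 0`.
  · simp at hn
  -- Membership of `x` and of `-x` are proved together so that the property is stable under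
  -- negation: `Z X` is generated by the classes as a group only.
  have key : ∀ x : X.ZGroup (n + 1), x ∈ AddSubmonoid.closure (Set.range X.cls) ∧
      -x ∈ AddSubmonoid.closure (Set.range X.cls) := fun x => by
    induction x using X.ZGroup_induction with
    | h0 => exact ⟨zero_mem _, by rw [neg_zero]; exact zero_mem _⟩
    | hc A =>
      have := RInvertible.invertible_zcls X (h n hn A)
      rwa [zcls, cls_psiAll] at this
    | hn x h => exact ⟨h.2, by rw [neg_neg]; exact h.1⟩
    | ha x y h₁ h₂ =>
      exact ⟨add_mem h₁.1 h₂.1, by rw [neg_add]; exact add_mem h₁.2 h₂.2⟩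
  exact eq_top_iff.2 fun x _ => (key x).1

end CubicalOmegaCategory

/-! ### Words with two distinguished adjacent letters. -/

namespace CubeWord

variable {n : ℕ} (i : Fin (n + 1)) (x y : Option Bool) (u : CubeWord n)

theorem nat_ins₂_left : nat (ins i.succ y (ins i x u)) i.val = x := by
  simp [nat_ins]

theorem nat_ins₂_right : nat (ins i.succ y (ins i x u)) (i.val + 1) = y := by
  simp [nat_ins]

/-- An insertion at place `i` pushes the letter already there to place `i + 1`. This brings words to
the normal form `ins i.succ y (ins i x u)`, with `x` at place `i` and `y` at place `i + 1`. -/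
theorem ins_castSucc_ins : ins i.castSucc y (ins i x u) = ins i.succ x (ins i y u) :=
  nat_ext fun j _ => by
    simp only [nat_ins, Fin.val_succ, Fin.val_castSucc]
    grind

theorem ins₂_apply_castSucc : ins i.succ y (ins i x u) i.castSucc = x := by
  rw [← ins_castSucc_ins, ins_self]

theorem ins₂_comp_swap :
    ins i.succ y (ins i x u) ∘ Equiv.swap i.castSucc i.succ = ins i.succ x (ins i y u) := by
  funext j
  rw [Function.comp_apply]
  rcases eq_or_ne j i.castSucc with rfl | h₁
  · rw [Equiv.swap_apply_left, ins_self, ins₂_apply_castSucc]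
  rcases eq_or_ne j i.succ with rfl | h₂
  · rw [Equiv.swap_apply_right, ins_self, ins₂_apply_castSucc]
  rw [Equiv.swap_apply_of_ne_of_ne h₁ h₂, ← nat_val (ins i.succ y (ins i x u)),
    ← nat_val (ins i.succ x (ins i y u))]
  simp only [ne_eq, Fin.ext_iff, Fin.val_castSucc, Fin.val_succ] at h₁ h₂
  simp only [nat_ins, Fin.val_succ]
  grind

end CubeWord

/-! ### Inverses and foldings in `N K`. -/

namespace ADC

variable {K : ADC.{u}}

theorem val_eq_ev {n k : ℕ} (A : K.N.cell n) (s : CubeSet n k) :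
    val A s = Hom.ev A k s.1 := (Hom.ev_val A s).symm

/-- In the degrees other than the dimension of the word, `ev` is `0` by convention, and `0` is
invertible. -/
theorem Hom.invertible_ev {n k : ℕ} (A : Hom (cube n) K) (s : CubeWord n)
    (h : ∀ hs : s.dim = k, K.Invertible (val A ⟨s, hs⟩)) : K.Invertible (A.ev k s) := by
  by_cases hs : s.dim = k
  · exact val_eq_ev A ⟨s, hs⟩ ▸ h hs
  · rw [A.ev_of_ne k s hs]
    exact ⟨zero_mem _, by rw [neg_zero]; exact zero_mem _⟩

/-! ### Inverses in direction `i` -/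

/-- The values of the `Rᵢ`-inverse of `A`. -/
def flipVal {n : ℕ} (i : Fin (n + 1)) (A : Hom (cube (n + 1)) K) (k : ℕ)
    (s : CubeWord (n + 1)) : K.X k :=
  if s i = none then -A.ev k s else A.ev k (Function.update s i ((s i).map not))

theorem flipVal_ins {n : ℕ} (i : Fin (n + 1)) (A : Hom (cube (n + 1)) K) (k : ℕ)
    (a : Option Bool) (s : CubeWord n) : flipVal i A k (s.ins i a) =
      if a = none then -A.ev k (s.ins i a) else A.ev k (s.ins i (a.map not)) := by
  rw [flipVal, CubeWord.ins_self, CubeWord.update_ins_self]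

/-- The `Rᵢ`-inverse of `A`. -/
def nFlip {n : ℕ} (i : Fin (n + 1)) (A : Hom (cube (n + 1)) K)
    (hA : ∀ (k : ℕ) (s : CubeSet (n + 1) k), s.1 i = none → K.Invertible (val A s)) :
    Hom (cube (n + 1)) K :=
  Hom.mk' (flipVal i A)
    (fun k s hs => by
      obtain ⟨a, u, rfl⟩ := CubeWord.exists_ins i s
      rw [flipVal_ins]
      rcases a with _ | a
      · rw [if_pos rfl, A.ev_of_ne k _ hs, neg_zero]
      · rw [if_neg (by simp), A.ev_of_ne]
        simpa [CubeWord.dim_ins] using hs)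
    -- If the letter at place `i` is `⊙`, its own term changes sign because the two ends are
    -- exchanged, and the other terms change sign because they keep that `⊙`. If it is a sign, no
    -- term of the boundary touches place `i`.
    (fun k s => by
      obtain ⟨a, u, rfl⟩ := CubeWord.exists_ins i s
      rcases a with _ | a
      · rw [flipVal_ins, if_pos rfl, map_neg, A.d_ev, CubeWord.bdry_ins, CubeWord.bdry_ins]
        simp only [flipVal_ins, reduceCtorEq, if_true, if_false, Option.map_some, Bool.not_true,
          Bool.not_false, neg_add, ← Finset.sum_neg_distrib, ← smul_neg, neg_sub, neg_sub_neg]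
      · rw [flipVal_ins, if_neg (by simp), A.d_ev, Option.map_some, CubeWord.bdry_ins_some,
          CubeWord.bdry_ins_some]
        simp only [flipVal_ins, reduceCtorEq, if_false, Option.map_some])
    (fun s hs => by
      obtain ⟨a, u, rfl⟩ := CubeWord.exists_ins i s
      rw [flipVal_ins]
      rcases a with _ | a
      · simp [CubeWord.dim_ins] at hs
      · rw [if_neg (by simp), A.e_ev]
        simpa [CubeWord.dim_ins] using hs)
    -- The only use of the hypothesis: the opposite of `A[s]` has to be distinguished.
    (fun k s => by
      unfold flipVal
      split_ifs with h
      · exact (A.invertible_ev s fun hs => hA k ⟨s, hs⟩ h).2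
      · exact A.ev_mem k _)

/-- At `⊙` the values of `A` and `B` cancel, as the degeneracy requires. At a sign the composite
takes the value of one of the two factors, and the flip in `B` turns this into the required face of
`A`. Invertibility plays no role once `B` is given as a cell. -/
theorem isRInverse_of_ev {n : ℕ} (i : Fin (n + 1)) (A B : Hom (cube (n + 1)) K)
    (h : ∀ k s, B.ev k s = flipVal i A k s) : K.N.IsRInverse i A B := by
  have h₁ : nFace i true A = nFace i false B := Hom.ext_ev fun k s => by
    rw [ev_nFace, ev_nFace, h, flipVal_ins]; simp
  have h₂ : nFace i true B = nFace i false A := Hom.ext_ev fun k s => by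
    rw [ev_nFace, ev_nFace, h, flipVal_ins]; simp
  refine ⟨⟨h₁, ?_⟩, ⟨h₂, ?_⟩⟩
  · change nComp i A B h₁ = nDeg i (nFace i false A)
    refine Hom.ext_ev fun k s => ?_
    obtain ⟨a, u, rfl⟩ := CubeWord.exists_ins i s
    rw [ev_nComp, ev_nDeg_nFace, h, flipVal_ins, CubeWord.nat_val, CubeWord.ins_self,
      CubeWord.update_ins_self]
    rcases a with _ | _ | _ <;> simp
  · change nComp i B A h₂ = nDeg i (nFace i true A)
    refine Hom.ext_ev fun k s => ?_
    obtain ⟨a, u, rfl⟩ := CubeWord.exists_ins i s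
    rw [ev_nComp, ev_nDeg_nFace, h, flipVal_ins, CubeWord.nat_val, CubeWord.ins_self,
      CubeWord.update_ins_self]
    rcases a with _ | _ | _ <;> simp

theorem rInvertible_of_val {n : ℕ} (i : Fin (n + 1)) (A : K.N.cell (n + 1))
    (hA : ∀ (k : ℕ) (s : CubeSet (n + 1) k), s.1 i = none → K.Invertible (val A s)) :
    K.N.RInvertible i A :=
  ⟨nFlip i A hA, isRInverse_of_ev i A _ fun _ _ => Hom.ev_mk' _ _ _ _ _ _ _⟩

/-- One of the two composites suffices, so that even a one-sided inverse is given by the formula. -/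
theorem ev_of_isRInverse {n : ℕ} {i : Fin (n + 1)} {A B : Hom (cube (n + 1)) K}
    (h : K.N.IsRInverse i A B) (k : ℕ) (s : CubeWord (n + 1)) :
    B.ev k s = flipVal i A k s := by
  obtain ⟨⟨h₁, h₂⟩, -⟩ := h
  change nFace i true A = nFace i false B at h₁
  change nComp i A B h₁ = nDeg i (nFace i false A) at h₂
  have key := congrArg (fun C : Hom (cube (n + 1)) K => C.ev k s) h₂
  obtain ⟨a, u, rfl⟩ := CubeWord.exists_ins i s
  simp only [ev_nComp, ev_nDeg_nFace, CubeWord.nat_val, CubeWord.ins_self,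
    CubeWord.update_ins_self] at key
  rw [flipVal_ins]
  -- At `⊙` the composite gives `A[s] + B[s] = 0`. At `-` the condition that `A ⋆ᵢ B` is defined
  -- gives the value. At `+` the composite is `B[s]`, and the degeneracy is the negative face of
  -- `A`.
  rcases a with _ | _ | _
  · simpa using eq_neg_of_add_eq_zero_right (by simpa using key)
  · simpa using (ev_of_nFace_eq h₁ k u).symm
  · simpa using key

theorem val_of_isRInverse {n k : ℕ} {i : Fin (n + 1)} {A B : K.N.cell (n + 1)}
    (h : K.N.IsRInverse i A B) (s : CubeSet (n + 1) k) :
    val B s = if s.1 i = none then -val A s else val A (s.flip i) := by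
  rw [val_eq_ev, val_eq_ev, val_eq_ev, ev_of_isRInverse h]
  rfl

/-! ### Inverses for the exchange of two directions -/

/-- The values of the `Tᵢ`-inverse of `A`. -/
def swapVal {n : ℕ} (i : Fin (n + 1)) (A : Hom (cube (n + 2)) K) (k : ℕ)
    (s : CubeWord (n + 2)) : K.X k :=
  if s i.castSucc = none ∧ s i.succ = none then -A.ev k s
  else A.ev k (s ∘ Equiv.swap i.castSucc i.succ)

theorem swapVal_ins₂ {n : ℕ} (i : Fin (n + 1)) (A : Hom (cube (n + 2)) K) (k : ℕ)
    (x y : Option Bool) (u : CubeWord n) :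
    swapVal i A k ((u.ins i x).ins i.succ y) =
      if x = none ∧ y = none then -A.ev k ((u.ins i x).ins i.succ y)
      else A.ev k ((u.ins i y).ins i.succ x) := by
  rw [swapVal, CubeWord.ins₂_apply_castSucc, CubeWord.ins_self, CubeWord.ins₂_comp_swap]

/-- In a boundary, the letters of a pair `⊙⊙` contribute with opposite coefficients `c` and `-c`.
Exchanging the two places therefore reverses the sign, which the minus sign in `swapVal`
compensates. A single `⊙` has coefficient `c` at either place, and the signs of the remaining terms
are symmetric in the two letters, so the plain exchange commutes with the boundary there. -/
theorem swapVal_d {n : ℕ} (i : Fin (n + 1)) (A : Hom (cube (n + 2)) K) (k : ℕ)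
    (s : CubeWord (n + 2)) :
    K.d k (swapVal i A (k + 1) s) = CubeWord.bdry (swapVal i A k) s := by
  obtain ⟨x, y, u, rfl⟩ := CubeWord.exists_ins₂ i s
  obtain ⟨c, ε, h⟩ := CubeWord.bdry_ins₂ (M := K.X k) i u
  rw [(h x y).2, swapVal_ins₂]
  simp only [swapVal_ins₂]
  by_cases hxy : x = none ∧ y = none
  · obtain ⟨rfl, rfl⟩ := hxy
    rw [if_pos ⟨rfl, rfl⟩, map_neg, A.d_ev, (h none none).2]
    simp only [if_true, reduceCtorEq, and_true, and_false, and_self, if_false, neg_add,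
      ← Finset.sum_neg_distrib, ← smul_neg, neg_sub, neg_sub_neg]
    module
  · rw [if_neg hxy, A.d_ev, (h y x).2]
    rcases x with _ | x <;> rcases y with _ | y <;> simp at hxy ⊢

/-- The `Tᵢ`-inverse of `A`. -/
def nSwap {n : ℕ} (i : Fin (n + 1)) (A : Hom (cube (n + 2)) K)
    (hA : ∀ (k : ℕ) (s : CubeSet (n + 2) k), s.1 i.castSucc = none → s.1 i.succ = none →
      K.Invertible (val A s)) :
    Hom (cube (n + 2)) K :=
  Hom.mk' (swapVal i A)
    (fun k s hs => by
      obtain ⟨x, y, u, rfl⟩ := CubeWord.exists_ins₂ i s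
      rw [swapVal_ins₂, A.ev_of_ne k _ hs, A.ev_of_ne, neg_zero, ite_self]
      rw [CubeWord.dim_insert2] at hs ⊢
      omega)
    (swapVal_d i A)
    (fun s hs => by
      obtain ⟨x, y, u, rfl⟩ := CubeWord.exists_ins₂ i s
      rw [swapVal_ins₂, if_neg, A.e_ev]
      · rw [CubeWord.dim_insert2] at hs ⊢
        omega
      · rintro ⟨rfl, rfl⟩
        simp [CubeWord.dim_insert2] at hs)
    -- As for `nFlip`, invertibility serves only to make the opposite values distinguished.
    (fun k s => by
      unfold swapVal
      split_ifs with h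
      · exact (A.invertible_ev s fun hs => hA k ⟨s, hs⟩ h.1 h.2).2
      · exact A.ev_mem k _)

/-- This form evaluates all the connections of the `T`-equation on words with letters `x`, `y` at
the two places; the merged letter `z` ends up at place `i + 1`, because the face puts `α` in front
of it. -/
theorem ev_nConn_nFace_castSucc {n : ℕ} (i : Fin (n + 1)) (α β : Bool) (A : Hom (cube (n + 2)) K)
    (k : ℕ) (x y : Option Bool) (u : CubeWord n) :
    (nConn i β (nFace i.castSucc α A)).ev k ((u.ins i x).ins i.succ y) =
      (CubeWord.merge β x y).elim 0 fun z => A.ev k ((u.ins i (some α)).ins i.succ z) := by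
  simp only [ev_nConn, CubeWord.nat_ins₂_left, CubeWord.nat_ins₂_right, CubeWord.del_ins,
    CubeWord.update_ins_self, ev_nFace, CubeWord.ins_castSucc_ins]

theorem ev_nConn_nFace_succ {n : ℕ} (i : Fin (n + 1)) (α β : Bool) (A : Hom (cube (n + 2)) K)
    (k : ℕ) (x y : Option Bool) (u : CubeWord n) :
    (nConn i β (nFace i.succ α A)).ev k ((u.ins i x).ins i.succ y) =
      (CubeWord.merge β x y).elim 0 fun z => A.ev k ((u.ins i z).ins i.succ (some α)) := by
  simp only [ev_nConn, CubeWord.nat_ins₂_left, CubeWord.nat_ins₂_right, CubeWord.del_ins,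
    CubeWord.update_ins_self, ev_nFace]

theorem ev_nComp_castSucc {n : ℕ} (i : Fin (n + 1)) (A B : Hom (cube (n + 2)) K) (h) (k : ℕ)
    (x y : Option Bool) (u : CubeWord n) :
    (nComp i.castSucc A B h).ev k ((u.ins i x).ins i.succ y) =
      match x with
      | none => A.ev k ((u.ins i x).ins i.succ y) + B.ev k ((u.ins i x).ins i.succ y)
      | some false => A.ev k ((u.ins i x).ins i.succ y)
      | some true => B.ev k ((u.ins i x).ins i.succ y) := by
  rw [ev_nComp, Fin.val_castSucc, CubeWord.nat_ins₂_left]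

theorem ev_nComp_succ {n : ℕ} (i : Fin (n + 1)) (A B : Hom (cube (n + 2)) K) (h) (k : ℕ)
    (x y : Option Bool) (u : CubeWord n) :
    (nComp i.succ A B h).ev k ((u.ins i x).ins i.succ y) =
      match y with
      | none => A.ev k ((u.ins i x).ins i.succ y) + B.ev k ((u.ins i x).ins i.succ y)
      | some false => A.ev k ((u.ins i x).ins i.succ y)
      | some true => B.ev k ((u.ins i x).ins i.succ y) := by
  rw [ev_nComp, Fin.val_succ, CubeWord.nat_ins₂_right]

/-- Both sides are compared on the nine possible pairs of letters. At `⊙⊙` the connections vanish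
and the values of `A` and `B` cancel; at the other pairs both sides reduce to values of `A`. -/
theorem tEquation_of_ev {n : ℕ} (i : Fin (n + 1)) (A B : Hom (cube (n + 2)) K)
    (h : ∀ k s, B.ev k s = swapVal i A k s) : K.N.TEquation i A B := by
  have h' : ∀ k x y u, B.ev k (CubeWord.ins i.succ y (CubeWord.ins i x u)) =
      if x = none ∧ y = none then -A.ev k ((u.ins i x).ins i.succ y)
      else A.ev k ((u.ins i y).ins i.succ x) := fun k x y u => by rw [h, swapVal_ins₂]
  have h₁ : nFace i.castSucc true (nConn i true (nFace i.castSucc false B)) =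
      nFace i.castSucc false B := by
    rw [nFace_nConn_castSucc, if_pos rfl]
  have h₂ : nFace i.castSucc true A =
      nFace i.castSucc false (nConn i false (nFace i.castSucc true A)) := by
    rw [nFace_nConn_castSucc, if_pos rfl]
  -- The equation includes that its composites are defined; `h₃` and `h₄` are the two
  -- compatibilities that depend on how `B` is related to `A`.
  have h₃ : nFace i.succ true (nComp i.castSucc (nConn i true (nFace i.castSucc false B)) B h₁) =
      nFace i.succ false
        (nComp i.castSucc A (nConn i false (nFace i.castSucc true A)) h₂) := by
    refine Hom.ext_ev fun k s => ?_
    obtain ⟨x, u, rfl⟩ := CubeWord.exists_ins i s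
    simp only [ev_nFace, ev_nComp_castSucc, ev_nConn_nFace_castSucc, h']
    rcases x with _ | _ | _ <;> simp [CubeWord.merge]
  have h₄ : nFace i.castSucc true (nConn i false (nFace i.castSucc false A)) =
      nFace i.castSucc false (nConn i true (nFace i.castSucc true B)) := by
    refine Hom.ext_ev fun k s => ?_
    obtain ⟨x, u, rfl⟩ := CubeWord.exists_ins i s
    simp only [ev_nFace, CubeWord.ins_castSucc_ins, ev_nConn_nFace_castSucc, h']
    rcases x with _ | _ | _ <;> simp [CubeWord.merge]
  refine ⟨h₁, h₂, h₃, h₄, ?_⟩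
  change nComp i.succ (nComp i.castSucc (nConn i true (nFace i.castSucc false B)) B h₁)
      (nComp i.castSucc A (nConn i false (nFace i.castSucc true A)) h₂) h₃ =
    nComp i.castSucc (nConn i false (nFace i.castSucc false A))
      (nConn i true (nFace i.castSucc true B)) h₄
  refine Hom.ext_ev fun k s => ?_
  obtain ⟨x, y, u, rfl⟩ := CubeWord.exists_ins₂ i s
  simp only [ev_nComp_castSucc, ev_nComp_succ, ev_nConn_nFace_castSucc, h']
  rcases x with _ | _ | _ <;> rcases y with _ | _ | _ <;> simp [CubeWord.merge]

/-- The exchange is an involution, so the conditions with `A` and `B` exchanged need no separate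
verification. -/
theorem swapVal_symm {n : ℕ} {i : Fin (n + 1)} {A B : Hom (cube (n + 2)) K}
    (h : ∀ k s, B.ev k s = swapVal i A k s) (k : ℕ) (s : CubeWord (n + 2)) :
    A.ev k s = swapVal i B k s := by
  obtain ⟨x, y, u, rfl⟩ := CubeWord.exists_ins₂ i s
  rw [swapVal_ins₂, h, h, swapVal_ins₂, swapVal_ins₂]
  by_cases hxy : x = none ∧ y = none
  · rw [if_pos hxy, if_pos hxy, neg_neg]
  · rw [if_neg hxy, if_neg fun h => hxy h.symm]

theorem nFace_castSucc_of_ev {n : ℕ} {i : Fin (n + 1)} {A B : Hom (cube (n + 2)) K}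
    (h : ∀ k s, B.ev k s = swapVal i A k s) (α : Bool) :
    nFace i.castSucc α A = nFace i.succ α B := by
  refine Hom.ext_ev fun k s => ?_
  obtain ⟨x, u, rfl⟩ := CubeWord.exists_ins i s
  rw [ev_nFace, ev_nFace, CubeWord.ins_castSucc_ins, h, swapVal_ins₂, if_neg (by simp)]

theorem isTInverse_of_ev {n : ℕ} (i : Fin (n + 1)) (A B : Hom (cube (n + 2)) K)
    (h : ∀ k s, B.ev k s = swapVal i A k s) : K.N.IsTInverse i A B :=
  ⟨nFace_castSucc_of_ev h, fun α => (nFace_castSucc_of_ev (swapVal_symm h) α).symm,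
    tEquation_of_ev i A B h, tEquation_of_ev i B A (swapVal_symm h)⟩

theorem tInvertible_of_val {n : ℕ} (i : Fin (n + 1)) (A : K.N.cell (n + 2))
    (hA : ∀ (k : ℕ) (s : CubeSet (n + 2) k), s.1 i.castSucc = none → s.1 i.succ = none →
      K.Invertible (val A s)) :
    K.N.TInvertible i A :=
  ⟨nSwap i A hA, isTInverse_of_ev i A _ fun _ _ => Hom.ev_mk' _ _ _ _ _ _ _⟩

/-- The face conditions give the values of `B` wherever one of the two letters is a sign. Only the
pair `⊙⊙` needs a `T`-equation, and one of the two is enough. -/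
theorem ev_of_isTInverse {n : ℕ} {i : Fin (n + 1)} {A B : Hom (cube (n + 2)) K}
    (h : K.N.IsTInverse i A B) (k : ℕ) (s : CubeWord (n + 2)) :
    B.ev k s = swapVal i A k s := by
  obtain ⟨f₁, f₂, ⟨h₁, h₂, h₃, h₄, h⟩, -⟩ := h
  change ∀ α, nFace i.castSucc α A = nFace i.succ α B at f₁
  change ∀ α, nFace i.succ α A = nFace i.castSucc α B at f₂
  change nFace i.castSucc true (nConn i true (nFace i.castSucc false B)) =
    nFace i.castSucc false B at h₁
  change nFace i.castSucc true A =
    nFace i.castSucc false (nConn i false (nFace i.castSucc true A)) at h₂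
  change nFace i.succ true (nComp i.castSucc (nConn i true (nFace i.castSucc false B)) B h₁) =
    nFace i.succ false
      (nComp i.castSucc A (nConn i false (nFace i.castSucc true A)) h₂) at h₃
  change nFace i.castSucc true (nConn i false (nFace i.castSucc false A)) =
    nFace i.castSucc false (nConn i true (nFace i.castSucc true B)) at h₄
  change nComp i.succ (nComp i.castSucc (nConn i true (nFace i.castSucc false B)) B h₁)
      (nComp i.castSucc A (nConn i false (nFace i.castSucc true A)) h₂) h₃ =
    nComp i.castSucc (nConn i false (nFace i.castSucc false A))
      (nConn i true (nFace i.castSucc true B)) h₄ at h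
  obtain ⟨x, y, u, rfl⟩ := CubeWord.exists_ins₂ i s
  rw [swapVal_ins₂]
  rcases x with _ | x
  · rcases y with _ | y
    · have key := congrArg (fun C : Hom (cube (n + 2)) K =>
        C.ev k (CubeWord.ins i.succ none (CubeWord.ins i none u))) h
      simp only [ev_nComp_castSucc, ev_nComp_succ, ev_nConn_nFace_castSucc] at key
      rw [if_pos ⟨rfl, rfl⟩]
      refine eq_neg_of_add_eq_zero_left ?_
      -- Merging `⊙` with `⊙` is degenerate, so every connection vanishes here and the equation
      -- reads `B[s] + A[s] = 0`.
      simpa [CubeWord.merge] using key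
    · have key := congrArg (fun C : Hom (cube (n + 1)) K => C.ev k (u.ins i none)) (f₁ y)
      rw [ev_nFace, ev_nFace, CubeWord.ins_castSucc_ins] at key
      rw [if_neg (by simp), key]
  · have key := congrArg (fun C : Hom (cube (n + 1)) K => C.ev k (u.ins i y)) (f₂ x)
    rw [ev_nFace, ev_nFace, CubeWord.ins_castSucc_ins] at key
    rw [if_neg (by simp), key]

theorem val_of_isTInverse {n k : ℕ} {i : Fin (n + 1)} {A B : K.N.cell (n + 2)}
    (h : K.N.IsTInverse i A B) (s : CubeSet (n + 2) k) :
    val B s = if s.1 i.castSucc = none ∧ s.1 i.succ = none then -val A s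
      else val A (s.swap i) := by
  rw [val_eq_ev, val_eq_ev, val_eq_ev, ev_of_isTInverse h]
  rfl

/-! ### Foldings -/

/-- At `⊙⊙` both connections vanish and `A` remains. At `⊙-` the value is that of the `Γ⁺` factor
and at `⊙+` that of the `Γ⁻` factor; in both cases the sign is not neutral for the connection, so
merging it with `⊙` is degenerate. -/
theorem ev_psi_of_none {n : ℕ} (i : Fin n) (A : Hom (cube (n + 1)) K) (k : ℕ)
    (s : CubeWord (n + 1)) (h : s i.castSucc = none) :
    Hom.ev (K.N.psi i A) k s = if s i.succ = none then A.ev k s else 0 := by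
  obtain _ | n := n
  · exact i.elim0
  obtain ⟨x, y, u, rfl⟩ := CubeWord.exists_ins₂ i s
  rw [CubeWord.ins₂_apply_castSucc] at h
  subst h
  have h₁ : nFace i.succ true (nConn i true (nFace i.succ false A)) = nFace i.succ false A := by
    rw [nFace_nConn_succ, if_pos rfl]
  have h₂ : nFace i.succ true (nComp i.succ (nConn i true (nFace i.succ false A)) A h₁) =
      nFace i.succ false (nConn i false (nFace i.succ true A)) := by
    rw [nFace_nComp_pos, nFace_nConn_succ, if_pos rfl]
  change Hom.ev (nComp i.succ (nComp i.succ (nConn i true (nFace i.succ false A)) A h₁)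
    (nConn i false (nFace i.succ true A)) h₂) k _ = _
  rw [ev_nComp_succ, ev_nComp_succ, ev_nConn_nFace_succ, ev_nConn_nFace_succ, CubeWord.ins_self]
  rcases y with _ | _ | _ <;> simp [CubeWord.merge]

/-- Dropping `j` indices leaves the composite `ψ` of the foldings from `j` on, with places counted
from `0`. The outermost folding kills the word if the letter after place `j` is a sign. If that
letter is `⊙`, the word passes unchanged to the next folding, until the first sign after place `j`
is met. -/
theorem ev_foldr_psi {n : ℕ} (A : Hom (cube (n + 1)) K) (j : ℕ) (hj : j ≤ n) (k : ℕ)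
    (s : CubeWord (n + 1)) (h₁ : s.nat j = none) (h₂ : ∃ l > j, s.nat l ≠ none) :
    Hom.ev (((List.finRange n).drop j).foldr (fun i B => K.N.psi i B) A) k s = 0 := by
  induction hj using Nat.decreasingInduction with
  -- At the last place no sign can follow, since `nat` is `⊙` outside of the word.
  | self =>
    obtain ⟨l, hl, h⟩ := h₂
    exact absurd (by rw [CubeWord.nat, dif_neg (by omega)]) h
  | of_succ j hj ih =>
    rw [List.drop_eq_getElem_cons (by simpa using hj), List.getElem_finRange]
    refine (ev_psi_of_none _ _ _ _ (by rw [← h₁, ← CubeWord.nat_val s]; rfl)).trans ?_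
    split_ifs with h
    · rw [← CubeWord.nat_val s] at h
      refine ih h ?_
      obtain ⟨l, hl, hs⟩ := h₂
      refine ⟨l, lt_of_le_of_ne hl ?_, hs⟩
      -- The sign is not at place `j + 1`, where the letter is `⊙`, so it still lies strictly after
      -- the new starting place.
      rintro rfl
      exact hs h
    · rfl

theorem ev_psiAll {n : ℕ} (A : Hom (cube (n + 1)) K) (k : ℕ) (s : CubeWord (n + 1))
    (h₁ : s 0 = none) (h₂ : s.dim ≠ n + 1) : Hom.ev (K.N.psiAll A) k s = 0 := by
  refine ev_foldr_psi A 0 n.zero_le k s (by rw [← h₁, ← CubeWord.nat_val s]; rfl) ?_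
  -- A word of less than full dimension contains a sign, and it is not the first letter, which is
  -- `⊙`.
  obtain ⟨l, hl⟩ : ∃ l, s l ≠ none := by
    by_contra! h
    exact h₂ (by simp [CubeWord.dim, h])
  refine ⟨l.val, Nat.pos_of_ne_zero fun h => hl ?_, by rwa [CubeWord.nat_val]⟩
  rwa [show l = 0 from Fin.ext h]

/-- Among the words that start with `⊙`, the folded cell is nonzero at most on the one of full
dimension `n + 1 > p`, where the distinguished submonoid of `K` is the whole group. -/
theorem IsOmegaP.N {p : ℕ∞} (h : K.IsOmegaP p) : K.N.IsOmegaP p := by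
  refine fun n hn A => rInvertible_of_val 0 _ fun k s hs => ?_
  by_cases hk : k = n + 1
  · subst hk
    rw [Invertible, h _ hn]
    exact ⟨trivial, trivial⟩
  · rw [val_eq_ev, ev_psiAll A k s.1 hs (by rwa [s.2])]
    exact ⟨zero_mem _, by rw [neg_zero]; exact zero_mem _⟩

end ADC

theorem proposition4p2p11 (X : CubicalOmegaCategory.{u}) (K : ADC.{v}) :
    ((∀ (n : ℕ) (i : Fin (n + 1)) (A : X.cell (n + 1)),
        X.RInvertible i A → X.Z.Invertible (X.zcls A)) ∧
      (∀ (n : ℕ) (i : Fin (n + 1)) (A : X.cell (n + 2)),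
        X.TInvertible i A → X.Z.Invertible (X.zcls A)) ∧
      (∀ p : ℕ∞, X.IsOmegaP p → X.Z.IsOmegaP p)) ∧
    ((∀ (n : ℕ) (i : Fin (n + 1)) (A : K.N.cell (n + 1)),
        (∀ (k : ℕ) (s : CubeSet (n + 1) k), s.1 i = none → K.Invertible (ADC.val A s)) →
          K.N.RInvertible i A ∧
            ∀ B : K.N.cell (n + 1), K.N.IsRInverse i A B →
              ∀ (k : ℕ) (s : CubeSet (n + 1) k),
                ADC.val B s = if s.1 i = none then -ADC.val A s else ADC.val A (s.flip i)) ∧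
      (∀ (n : ℕ) (i : Fin (n + 1)) (A : K.N.cell (n + 2)),
        (∀ (k : ℕ) (s : CubeSet (n + 2) k), s.1 i.castSucc = none → s.1 i.succ = none →
            K.Invertible (ADC.val A s)) →
          K.N.TInvertible i A ∧
            ∀ B : K.N.cell (n + 2), K.N.IsTInverse i A B →
              ∀ (k : ℕ) (s : CubeSet (n + 2) k),
                ADC.val B s = if s.1 i.castSucc = none ∧ s.1 i.succ = none then -ADC.val A s
                  else ADC.val A (s.swap i)) ∧
      (∀ p : ℕ∞, K.IsOmegaP p → K.N.IsOmegaP p)) :=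
  ⟨⟨fun _ _ _ h => h.invertible_zcls, fun _ _ _ h => h.invertible_zcls, fun _ h => h.Z⟩,
    fun _ i A h => ⟨ADC.rInvertible_of_val i A h, fun _ hB _ s => ADC.val_of_isRInverse hB s⟩,
    fun _ i A h => ⟨ADC.tInvertible_of_val i A h, fun _ hB _ s => ADC.val_of_isTInverse hB s⟩,
    fun _ h => h.N⟩
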